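/- Let $G=(V,E)$ be a finite simple graph with costs $c(v)\ge 0$ on its vertices, and let $\Gamma^+(v)$ be the set consisting of $v$ and its neighbours. A dominating set is a set $D\subseteq V$ such that every vertex outside $D$ has a neighbour in $D$. The standard LP relaxation of the minimum-cost dominating set problem is $$\min \sum_{v\in V} c(v)x(v)\quad\text{subject to}\quad \sum_{u\in\Gamma^+(v)}x(u)\ge 1\ \ (v\in V),\qquad x(v)\ge 0\ \ (v\in V);$$ its feasible points are called fractional solutions. **Theorem.** There is a single polynomial-time algorithm which, given a finite graph $G$, nonnegative rational costs $c$ and a rational fractional solution $x$, returns a dominating set $D$ of $G$ (the time is polynomial in the number of bits of the input $(G,c,x)$, on a random access machine with logarithmic cost), and for which the following hold. 1. For every minor-closed family $\mathcal G$ of finite graphs that does not contain all finite graphs, there is a constant $c(\mathcal G)$, depending only on $\mathcal G$, such that the integrality gap of the relaxation on $\mathcal G$ is at most $c(\mathcal G)$ (that is, for every graph in $\mathcal G$ and all nonnegative real costs, the minimum cost of a dominating set is at most $c(\mathcal G)$ times the optimal value of the relaxation), and such that, on every instance $(G,c,x)$ with $G\in\mathcal G$, the returned set satisfies $\sum_{v\in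 D}c(v)\le c(\mathcal G)\sum_{v\in V}c(v)x(v)$. 2. For the family of planar graphs, both assertions hold with the constant $10$. -/

import Mathlib

noncomputable section

namespace DomSet

open scoped Classical
open Finset

/-! ## Dominating sets and the linear programming relaxation -/

/-- `D` is a dominating set of `G`: every vertex outside `D` has a neighbour in `D`. -/
def IsDominating {V : Type*} (G : SimpleGraph V) (D : Finset V) : Prop :=
  ∀ v, v ∉ D → ∃ u ∈ D, G.Adj v u

/-- The closed neighbourhood `Γ⁺(v)` of a vertex. -/
def closedNbhd {V : Type*} [Fintype V] (G : SimpleGraph V) (v : V) : Finset V :=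
  {u | u = v ∨ G.Adj v u}

/-- `x` is a fractional solution, that is, a feasible point of the relaxation
`min ∑ c(v) x(v)` subject to `∑_{u ∈ Γ⁺(v)} x(u) ≥ 1` for all `v`, and `x ≥ 0`. -/
def IsFractional {V : Type*} [Fintype V] (G : SimpleGraph V) (x : V → ℝ) : Prop :=
  (∀ v, 1 ≤ ∑ u ∈ closedNbhd G v, x u) ∧ ∀ v, 0 ≤ x v

/-- The minimum cost of a dominating set. The set is finite and nonempty. -/
def dsOpt {V : Type*} [Fintype V] (G : SimpleGraph V) (c : V → ℝ) : ℝ :=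
  sInf {z | ∃ D : Finset V, IsDominating G D ∧ z = ∑ v ∈ D, c v}

/-- The optimal value of the relaxation. For `c ≥ 0` the set is nonempty (it contains the value of
`x = 1`) and bounded below by `0`. -/
def lpOpt {V : Type*} [Fintype V] (G : SimpleGraph V) (c : V → ℝ) : ℝ :=
  sInf {z | ∃ x : V → ℝ, IsFractional G x ∧ z = ∑ v, c v * x v}

/-! ## Families of finite graphs, minors, planarity -/

/-- A family of finite simple graphs; every finite graph is represented, up to isomorphism, on some
vertex set `Fin n`. -/
abbrev GraphFamily : Type := ∀ n : ℕ, Set (SimpleGraph (Fin n))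

/-- `H` is a minor of `G`: there are pairwise disjoint branch sets in `G`, one for each vertex
of `H`, each inducing a (nonempty) connected subgraph, such that the branch sets of adjacent
vertices of `H` are joined by an edge of `G`. -/
def IsMinor {W V : Type*} (H : SimpleGraph W) (G : SimpleGraph V) : Prop :=
  ∃ B : W → Set V,
    (∀ a, (G.induce (B a)).Connected) ∧
    (∀ a b, a ≠ b → Disjoint (B a) (B b)) ∧
    ∀ a b, H.Adj a b → ∃ u ∈ B a, ∃ v ∈ B b, G.Adj u v

/-- The family is closed under taking minors (and hence under isomorphism). -/
def GraphFamily.IsMinorClosed (F : GraphFamily) : Prop :=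
  ∀ (m n : ℕ) (H : SimpleGraph (Fin m)) (G : SimpleGraph (Fin n)),
    G ∈ F n → IsMinor H G → H ∈ F m

/-- The family does not contain all finite graphs. -/
def GraphFamily.IsProper (F : GraphFamily) : Prop :=
  ∃ (n : ℕ) (G : SimpleGraph (Fin n)), G ∉ F n

/-- A rotation system of `G`: a permutation of the darts (oriented edges) whose cycles are exactly
the sets of darts leaving a common vertex; it gives the cyclic order of the edges around each
vertex. -/
def IsRotationSystem {V : Type*} (G : SimpleGraph V) (σ : Equiv.Perm G.Dart) : Prop :=
  ∀ d e : G.Dart, σ.SameCycle d e ↔ d.fst = e.fst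

/-- The face permutation of a rotation system: traverse the dart `d`, and leave its head along the
dart that follows the reversal of `d` in the rotation. -/
def facePerm {V : Type*} {G : SimpleGraph V} (σ : Equiv.Perm G.Dart) : Equiv.Perm G.Dart :=
  (Function.Involutive.toPerm SimpleGraph.Dart.symm SimpleGraph.Dart.symm_involutive).trans σ

/-- The number of faces of the embedding given by a rotation system, counted component by
component: the facial walks, and one face for each isolated vertex. -/
def numFaces {V : Type*} {G : SimpleGraph V} (σ : Equiv.Perm G.Dart) : ℕ :=
  Nat.card (Quotient (Equiv.Perm.SameCycle.setoid (facePerm σ))) +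
    Nat.card {v : V // ∀ u, ¬ G.Adj v u}

/-- A finite graph is planar if it has a combinatorial embedding in the sphere: a rotation system
of genus zero on every connected component. A component with `V` vertices, `E` edges and `F` faces
has genus `(2 - V + E - F) / 2 ≥ 0`, so all genera vanish if and only if
`V - E + F = 2 * (number of components)`. -/
def IsPlanar {V : Type*} (G : SimpleGraph V) : Prop :=
  ∃ σ : Equiv.Perm G.Dart, IsRotationSystem G σ ∧
    Nat.card V + numFaces σ = Nat.card G.edgeSet + 2 * Nat.card G.ConnectedComponent

/-- The family of planar graphs. -/
def planarGraphs : GraphFamily := fun _ => {G | IsPlanar G}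

/-- The integrality gap of the relaxation, over the graphs of `F` and all nonnegative real costs,
is at most `r`. -/
def IntegralityGapLE (F : GraphFamily) (r : ℝ) : Prop :=
  ∀ (n : ℕ) (G : SimpleGraph (Fin n)), G ∈ F n → ∀ c : Fin n → ℝ, (∀ v, 0 ≤ c v) →
    dsOpt G c ≤ r * lpOpt G c

/-! ## Random access machines with logarithmic cost -/

/-- Arithmetic operations of the machine, on natural numbers. -/
inductive ArithOp : Type
  | add | sub | mul | div

/-- The value of an operation; subtraction is truncated, division is rounded down. -/
def ArithOp.eval : ArithOp → ℕ → ℕ → ℕ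
  | .add, a, b => a + b
  | .sub, a, b => a - b
  | .mul, a, b => a * b
  | .div, a, b => a / b

/-- Programs of a random access machine with registers `R` and a memory `M`. -/
inductive Prog : Type
  /-- `R[d] := k` -/
  | const (d k : ℕ)
  /-- `R[d] := R[a] ∘ R[b]` -/
  | arith (o : ArithOp) (d a b : ℕ)
  /-- `R[d] := M[R[a]]` -/
  | load (d a : ℕ)
  /-- `M[R[a]] := R[b]` -/
  | store (a b : ℕ)
  /-- First `p`, then `q`. -/
  | seq (p q : Prog)
  /-- If `R[a] ≠ 0` then `p` else `q`. -/
  | ite (a : ℕ) (p q : Prog)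
  /-- While `R[a] ≠ 0` do `p`. -/
  | loop (a : ℕ) (p : Prog)

/-- The state of the machine. A program mentions only finitely many registers; memory cells are
addressed by the contents of registers. -/
structure State : Type where
  /-- The contents of the registers. -/
  reg : ℕ → ℕ
  /-- The contents of the memory. -/
  mem : ℕ → ℕ

/-- Write `k` into register `d`. -/
def State.setReg (s : State) (d k : ℕ) : State := ⟨Function.update s.reg d k, s.mem⟩

/-- Write `k` into memory cell `i`. -/
def State.setMem (s : State) (i k : ℕ) : State := ⟨s.reg, Function.update s.mem i k⟩

/-- `Exec p s s' t`: started in state `s`, the program `p` halts in state `s'`, in time `t`. Each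
instruction, and each test, costs one plus the number of binary digits of the numbers (contents and
computed addresses) on which it operates. -/
inductive Exec : Prog → State → State → ℕ → Prop
  | const (d k : ℕ) (s : State) :
      Exec (.const d k) s (s.setReg d k) (1 + k.size)
  | arith (o : ArithOp) (d a b : ℕ) (s : State) :
      Exec (.arith o d a b) s (s.setReg d (o.eval (s.reg a) (s.reg b)))
        (1 + (s.reg a).size + (s.reg b).size)
  | load (d a : ℕ) (s : State) :
      Exec (.load d a) s (s.setReg d (s.mem (s.reg a)))
        (1 + (s.reg a).size + (s.mem (s.reg a)).size)
  | store (a b : ℕ) (s : State) :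
      Exec (.store a b) s (s.setMem (s.reg a) (s.reg b))
        (1 + (s.reg a).size + (s.reg b).size)
  | seq {p q : Prog} {s s' s'' : State} {t t' : ℕ} :
      Exec p s s' t → Exec q s' s'' t' → Exec (.seq p q) s s'' (t + t')
  | ite_true {a : ℕ} {p q : Prog} {s s' : State} {t : ℕ} :
      s.reg a ≠ 0 → Exec p s s' t → Exec (.ite a p q) s s' (1 + (s.reg a).size + t)
  | ite_false {a : ℕ} {p q : Prog} {s s' : State} {t : ℕ} :
      s.reg a = 0 → Exec q s s' t → Exec (.ite a p q) s s' (1 + (s.reg a).size + t)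
  | loop_step {a : ℕ} {p : Prog} {s s' s'' : State} {t t' : ℕ} :
      s.reg a ≠ 0 → Exec p s s' t → Exec (.loop a p) s' s'' t' →
        Exec (.loop a p) s s'' (1 + (s.reg a).size + t + t')
  | loop_end {a : ℕ} {p : Prog} {s : State} :
      s.reg a = 0 → Exec (.loop a p) s s (1 + (s.reg a).size)

/-- The start state on an input: the input stands in the memory cells `0, 1, 2, …`, and everything
else is zero. -/
def startState (input : List ℕ) : State := ⟨fun _ => 0, fun i => input.getD i 0⟩

/-- The size of an input: the total number of binary digits, plus one for each number. -/
def inputSize (input : List ℕ) : ℕ := (input.map fun k => 1 + k.size).sum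

/-! ## Rounding algorithms -/

/-- The input for a rounding algorithm: the number of vertices, the adjacency matrix row by row,
and then the costs and the values of the fractional solution, each as numerator and denominator. -/
def encode {n : ℕ} (G : SimpleGraph (Fin n)) (c x : Fin n → ℚ≥0) : List ℕ :=
  [n] ++
    ((List.finRange n).flatMap fun u =>
      (List.finRange n).map fun v => if G.Adj u v then 1 else 0) ++
    ((List.finRange n).flatMap fun v => [(c v).num, (c v).den]) ++
    ((List.finRange n).flatMap fun v => [(x v).num, (x v).den])

/-- On the instance `(G, c, x)` the program `P` halts in time `t` and returns the vertex set `D`: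
vertex `v` is in `D` if and only if memory cell `v` finally contains `1`. -/
def Returns (P : Prog) {n : ℕ} (G : SimpleGraph (Fin n)) (c x : Fin n → ℚ≥0)
    (D : Finset (Fin n)) (t : ℕ) : Prop :=
  ∃ s : State, Exec P (startState (encode G c x)) s t ∧ ∀ v : Fin n, v ∈ D ↔ s.mem v = 1

/-- `P` is a polynomial-time rounding algorithm for the relaxation: given a graph, nonnegative
rational costs, and a rational fractional solution, it halts in time polynomial in the number of
bits of the input, and returns a dominating set. -/
def IsPolyTimeRounding (P : Prog) : Prop :=
  ∃ p : Polynomial ℕ, ∀ (n : ℕ) (G : SimpleGraph (Fin n)) (c x : Fin n → ℚ≥0),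
    IsFractional G (fun v => (x v : ℝ)) →
      ∃ (D : Finset (Fin n)) (t : ℕ), Returns P G c x D t ∧
        t ≤ p.eval (inputSize (encode G c x)) ∧ IsDominating G D

/-- On the graphs of `F`, the set that `P` returns costs at most `r` times as much as the given
fractional solution. -/
def IsApproxOn (P : Prog) (F : GraphFamily) (r : ℝ) : Prop :=
  ∀ (n : ℕ) (G : SimpleGraph (Fin n)), G ∈ F n → ∀ c x : Fin n → ℚ≥0,
    IsFractional G (fun v => (x v : ℝ)) →
      ∀ (D : Finset (Fin n)) (t : ℕ), Returns P G c x D t →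
        (∑ v ∈ D, (c v : ℝ)) ≤ r * ∑ v, (c v : ℝ) * (x v : ℝ)

end DomSet

end

noncomputable section

namespace DomSet

open scoped Classical
open Finset

/-! ## Determinism of the machine -/

/-! The reason is that the graphs in question can be oriented with bounded outdegree. Suppose every
outdegree is at most `d`, and put `κ = 2 * d + 1`. Take the set `H` of all vertices of value at
least `1 / κ`, and for each vertex `v` not dominated by `H` add a cheapest vertex of its closed
neighbourhood, at a price `p v`. The set `H` costs at most `κ` times its share of the LP value. If
`v` is not dominated by `H`, its at most `d` out-neighbours have total value at most `d / κ`, so `v`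
and its in-neighbours have total value at least `(d + 1) / κ`. As `p v` is at most the cost of each
of them, `(d + 1) * p v` is at most `κ` times their contribution to the LP value. A vertex outside
`H` is charged in this way only by itself and by its out-neighbours, at most `d + 1` times. Hence
the total cost is at most `κ` times the LP value (`rounding_bound`).

Such orientations come from sparsity. If every edge set `A` has at most `d` times as many edges as
vertices that it touches, Hall's theorem assigns each edge to one of its ends so that no vertex
receives more than `d` edges (`hasOrientation_of_sparse`). A proper minor-closed family excludes a
complete graph on some `t` vertices. Mader's contraction argument shows that a graph with average
degree at least `2 ^ t` contains that minor (`hasCliqueModel_of_dense`), and `d = 2 ^ t` suffices.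
For planar graphs, deleting an edge from a rotation system does not increase the genus, so Euler's
inequality holds for every edge set. Counting faces then gives `d = 4` (`IsPlanar.card_le`), and the
factor `9` is below `10`.

The algorithm need not know the family or the orientation: it tries all thresholds `1 / (k + 1)`
with `k ≤ 2 * n` and keeps the cheapest set. It is written in a small language with bounded loops. A
soundness theorem for its compilation (`Cmd.exec_code`) turns bounds on the computed numbers and on
the loop lengths into a polynomial bound on the logarithmic cost. The machine is deterministic, so
what is proved about one run holds for every run. -/

theorem Exec.deterministic {p : Prog} {s s₁ s₂ : State} {t₁ t₂ : ℕ}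
    (h₁ : Exec p s s₁ t₁) (h₂ : Exec p s s₂ t₂) : s₁ = s₂ := by
  induction h₁ generalizing s₂ t₂ with
  | const | arith | load | store => cases h₂; rfl
  | seq _ _ ih₁ ih₂ =>
    cases h₂ with
    | seq h h' => cases ih₁ h; exact ih₂ h'
  | ite_true hne _ ih =>
    cases h₂ with
    | ite_true _ h => exact ih h
    | ite_false h0 _ => exact absurd h0 hne
  | ite_false h0 _ ih =>
    cases h₂ with
    | ite_true hne _ => exact absurd h0 hne
    | ite_false _ h => exact ih h
  | loop_step hne _ _ ih₁ ih₂ =>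
    cases h₂ with
    | loop_step _ h h' => cases ih₁ h; exact ih₂ h'
    | loop_end h0 => exact absurd h0 hne
  | loop_end h0 =>
    cases h₂ with
    | loop_step hne _ _ => exact absurd h0 hne
    | loop_end _ => rfl

/-! ## A structured language on top of the machine -/

/-- Expressions: variables, literals, arithmetic, and reading from memory. -/
inductive Ex : Type
  | var (r : ℕ)
  | lit (k : ℕ)
  | op (o : ArithOp) (e f : Ex)
  | get (e : Ex)

namespace Ex

/-- The value of an expression. -/
def eval (a : State) : Ex → ℕ
  | var r => a.reg r
  | lit k => k
  | op o e f => o.eval (e.eval a) (f.eval a)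
  | get e => a.mem (e.eval a)

/-- All values that occur in the evaluation are at most `M`. -/
def Bdd (M : ℕ) (a : State) : Ex → Prop
  | var r => a.reg r ≤ M
  | lit k => k ≤ M
  | op o e f => e.Bdd M a ∧ f.Bdd M a ∧ o.eval (e.eval a) (f.eval a) ≤ M
  | get e => e.Bdd M a ∧ a.mem (e.eval a) ≤ M

/-- The number of machine instructions for an expression. -/
def steps : Ex → ℕ
  | var _ => 2
  | lit _ => 1
  | op _ e f => e.steps + f.steps + 1
  | get e => e.steps + 1

/-- Code that evaluates an expression into the register `2 * k + 1`. The variable `r` is kept in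
the register `2 * r`. -/
def code : Ex → ℕ → Prog
  | var r, k => .seq (.const (2 * k + 1) 0) (.arith .add (2 * k + 1) (2 * r) (2 * k + 1))
  | lit c, k => .const (2 * k + 1) c
  | op o e f, k => .seq (e.code k) (.seq (f.code (k + 1))
      (.arith o (2 * k + 1) (2 * k + 1) (2 * (k + 1) + 1)))
  | get e, k => .seq (e.code k) (.load (2 * k + 1) (2 * k + 1))

theorem Bdd.eval_le {M : ℕ} {a : State} {e : Ex} (h : e.Bdd M a) : e.eval a ≤ M := by
  cases e with
  | var r => exact h
  | lit k => exact h
  | op o e f => exact h.2.2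
  | get e => exact h.2

end Ex

/-- The values of the variables and the memory. -/
def State.vars (s : State) : State := ⟨fun r => s.reg (2 * r), s.mem⟩

theorem State.vars_setReg_odd (s : State) (k c : ℕ) : (s.setReg (2 * k + 1) c).vars = s.vars := by
  unfold State.vars State.setReg
  congr 1
  funext r
  exact Function.update_of_ne (by omega) _ _

theorem State.vars_setReg_even (s : State) (r c : ℕ) :
    (s.setReg (2 * r) c).vars = s.vars.setReg r c := by
  unfold State.vars State.setReg
  congr 1
  funext i
  by_cases h : i = r
  · subst h; simp
  · simp [h]

/-- The two states agree on the registers `2 * j + 1` with `j < k`. -/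
def State.Agree (k : ℕ) (s s' : State) : Prop := ∀ j < k, s'.reg (2 * j + 1) = s.reg (2 * j + 1)

theorem State.Agree.trans {k : ℕ} {s s' s'' : State} (h : s.Agree k s') (h' : s'.Agree k s'') :
    s.Agree k s'' := fun j hj => (h' j hj).trans (h j hj)

theorem State.Agree.mono {k l : ℕ} (hkl : k ≤ l) {s s' : State} (h : s.Agree l s') :
    s.Agree k s' := fun j hj => h j (by omega)

theorem State.agree_setReg {k d c : ℕ} (s : State) (hd : ∀ j < k, 2 * j + 1 ≠ d) :
    s.Agree k (s.setReg d c) := fun j hj => Function.update_of_ne (hd j hj) _ _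

/-- Scratch registers of lower levels survive, so the value of a left operand can wait while the
right operand is computed one level higher. An instruction handles at most two numbers, each at most
`M`, and therefore costs at most `1 + 2 * M.size`. -/
theorem Ex.exec_code {M : ℕ} (e : Ex) : ∀ (k : ℕ) (s : State), e.Bdd M s.vars →
    ∃ s' t, Exec (e.code k) s s' t ∧ s'.vars = s.vars ∧ s'.reg (2 * k + 1) = e.eval s.vars ∧
      s.Agree k s' ∧ t ≤ e.steps * (1 + 2 * M.size) := by
  induction e with
  | var r =>
    intro k s h
    refine ⟨_, _, .seq (.const _ _ _) (.arith _ _ _ _ _), ?_, ?_, ?_, ?_⟩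
    · rw [State.vars_setReg_odd, State.vars_setReg_odd]
    · have : (2 * r) ≠ 2 * k + 1 := by omega
      simp [State.setReg, ArithOp.eval, Ex.eval, State.vars, Function.update_of_ne this]
    · exact (s.agree_setReg fun j hj => by omega).trans (State.agree_setReg _ fun j hj => by omega)
    · have h1 : (s.reg (2 * r)).size ≤ M.size := Nat.size_le_size h
      have : (2 * r) ≠ 2 * k + 1 := by omega
      simp only [State.setReg, Function.update_of_ne this, Function.update_self, Ex.steps,
        Nat.size_zero]
      omega
  | lit c =>
    intro k s h
    refine ⟨_, _, .const _ _ _, State.vars_setReg_odd _ _ _, ?_, ?_, ?_⟩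
    · simp [State.setReg, Ex.eval]
    · exact s.agree_setReg fun j hj => by omega
    · have h1 : c.size ≤ M.size := Nat.size_le_size h
      simp only [Ex.steps]
      omega
  | op o e f ihe ihf =>
    intro k s h
    obtain ⟨s₁, t₁, x₁, v₁, r₁, a₁, b₁⟩ := ihe k s h.1
    obtain ⟨s₂, t₂, x₂, v₂, r₂, a₂, b₂⟩ := ihf (k + 1) s₁ (v₁ ▸ h.2.1)
    have r₃ : s₂.reg (2 * k + 1) = e.eval s.vars := by rw [a₂ k (by omega), r₁]
    have r₄ : s₂.reg (2 * (k + 1) + 1) = f.eval s.vars := by rw [r₂, v₁]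
    refine ⟨_, _, .seq x₁ (.seq x₂ (.arith _ _ _ _ _)), ?_, ?_, ?_, ?_⟩
    · rw [State.vars_setReg_odd, v₂, v₁]
    · simp only [State.setReg, Function.update_self, r₃, r₄, Ex.eval]
    · exact a₁.trans ((a₂.mono (by omega)).trans (State.agree_setReg _ fun j hj => by omega))
    · have h1 := Nat.size_le_size h.1.eval_le
      have h2 := Nat.size_le_size h.2.1.eval_le
      rw [r₃, r₄]
      simp only [Ex.steps, add_mul, one_mul]
      omega
  | get e ih =>
    intro k s h
    obtain ⟨s₁, t₁, x₁, v₁, r₁, a₁, b₁⟩ := ih k s h.1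
    have hm : s₁.vars.mem = s.vars.mem := congrArg State.mem v₁
    change s₁.mem = s.mem at hm
    refine ⟨_, _, .seq x₁ (.load _ _ _), ?_, ?_, ?_, ?_⟩
    · rw [State.vars_setReg_odd, v₁]
    · simp only [State.setReg, Function.update_self, r₁, Ex.eval, hm]; rfl
    · exact a₁.trans (State.agree_setReg _ fun j hj => by omega)
    · have h1 := Nat.size_le_size h.1.eval_le
      have h2 : (s.mem (e.eval s.vars)).size ≤ M.size := Nat.size_le_size h.2
      rw [r₁, hm]
      simp only [Ex.steps, add_mul, one_mul]
      omega

/-- Commands with bounded loops. -/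
inductive Cmd : Type
  | skip
  | set (r : ℕ) (e : Ex)
  | put (e f : Ex)
  | seq (c d : Cmd)
  | cond (e : Ex) (c d : Cmd)
  /-- Repeat `c` as many times as the initial value of `e` says; `i` counts the rounds. -/
  | rep (i : ℕ) (e : Ex) (c : Cmd)

namespace Cmd

/-- The machine code of a command; it uses the registers `2 * j + 1` with `j ≥ k` as scratch
space. -/
def code : Cmd → ℕ → Prog
  | skip, k => .const (2 * k + 1) 0
  | set r e, k => .seq (e.code k)
      (.seq (.const (2 * r) 0) (.arith .add (2 * r) (2 * r) (2 * k + 1)))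
  | put e f, k => .seq (e.code k) (.seq (f.code (k + 1)) (.store (2 * k + 1) (2 * (k + 1) + 1)))
  | seq c d, k => .seq (c.code k) (d.code k)
  | cond e c d, k => .seq (e.code k) (.ite (2 * k + 1) (c.code k) (d.code k))
  | rep i e c, k => .seq (e.code k) (.seq (.const (2 * i) 0) (.loop (2 * k + 1)
      (.seq (c.code (k + 1)) (.seq (.const (2 * (k + 1) + 1) 1)
        (.seq (.arith .add (2 * i) (2 * i) (2 * (k + 1) + 1))
          (.arith .sub (2 * k + 1) (2 * k + 1) (2 * (k + 1) + 1)))))))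

open Polynomial in
/-- A bound for the number of machine instructions, as a polynomial in a bound for the lengths of
the loops. -/
def steps : Cmd → Polynomial ℕ
  | skip => 1
  | set _ e => C e.steps + 2
  | put e f => C e.steps + C f.steps + 1
  | seq c d => c.steps + d.steps
  | cond e c d => C e.steps + 1 + c.steps + d.steps
  | rep _ e c => C e.steps + 2 + X * (c.steps + 4)

/-- Weakest precondition for values bounded by `M` and loop lengths bounded by `N`. -/
def wp (M N : ℕ) : Cmd → (State → Prop) → State → Prop
  | skip, Q => Q
  | set r e, Q => fun a => e.Bdd M a ∧ Q (a.setReg r (e.eval a))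
  | put e f, Q => fun a => e.Bdd M a ∧ f.Bdd M a ∧ Q (a.setMem (e.eval a) (f.eval a))
  | seq c d, Q => c.wp M N (d.wp M N Q)
  | cond e c d, Q => fun a => e.Bdd M a ∧ (e.eval a ≠ 0 → c.wp M N Q a) ∧
      (e.eval a = 0 → d.wp M N Q a)
  | rep i e c, Q => fun a => e.Bdd M a ∧ e.eval a ≤ N ∧ ∃ I : ℕ → State → Prop,
      I 0 (a.setReg i 0) ∧
      (∀ j < e.eval a, ∀ b, I j b →
        c.wp M N (fun b' => b'.reg i ≤ M ∧ I (j + 1) (b'.setReg i (b'.reg i + 1))) b) ∧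
      ∀ b, I (e.eval a) b → Q b

/-- Soundness of `wp` for the compiled code. Since loop lengths are bounded by `N`, termination and
the time bound come with the postcondition. -/
theorem exec_code {M N : ℕ} (hM : 1 ≤ M) (c : Cmd) : ∀ (k : ℕ) (s : State) (Q : State → Prop),
    c.wp M N Q s.vars →
    ∃ s' t, Exec (c.code k) s s' t ∧ Q s'.vars ∧ s.Agree k s' ∧
      t ≤ c.steps.eval N * (1 + 2 * M.size) := by
  have one_size : (1 : ℕ).size ≤ M.size := Nat.size_le_size hM
  induction c with
  | skip =>
    intro k s Q h
    refine ⟨_, _, .const _ _ _, ?_, s.agree_setReg fun j hj => by omega, ?_⟩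
    · rw [State.vars_setReg_odd]; exact h
    · simp [steps]
  | set r e =>
    intro k s Q h
    obtain ⟨s₁, t₁, x₁, v₁, r₁, a₁, b₁⟩ := e.exec_code k s h.1
    have hne : 2 * k + 1 ≠ 2 * r := by omega
    have h1 := Nat.size_le_size h.1.eval_le
    refine ⟨_, _, .seq x₁ (.seq (.const _ _ _) (.arith _ _ _ _ _)), ?_, ?_, ?_⟩
    · rw [State.vars_setReg_even, State.vars_setReg_even, v₁]
      simpa [State.setReg, ArithOp.eval, Function.update_of_ne hne, r₁] using h.2
    · exact a₁.trans ((State.agree_setReg _ fun j hj => by omega).trans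
        (State.agree_setReg _ fun j hj => by omega))
    · simp only [State.setReg, Function.update_of_ne hne, Function.update_self, r₁, steps,
        Polynomial.eval_add, Polynomial.eval_C, Polynomial.eval_ofNat, Nat.size_zero, add_mul]
      omega
  | put e f =>
    intro k s Q h
    obtain ⟨s₁, t₁, x₁, v₁, r₁, a₁, b₁⟩ := e.exec_code k s h.1
    obtain ⟨s₂, t₂, x₂, v₂, r₂, a₂, b₂⟩ := f.exec_code (k + 1) s₁ (v₁ ▸ h.2.1)
    have r₃ : s₂.reg (2 * k + 1) = e.eval s.vars := by rw [a₂ k (by omega), r₁]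
    have r₄ : s₂.reg (2 * (k + 1) + 1) = f.eval s.vars := by rw [r₂, v₁]
    have h1 := Nat.size_le_size h.1.eval_le
    have h2 := Nat.size_le_size h.2.1.eval_le
    refine ⟨_, _, .seq x₁ (.seq x₂ (.store _ _ _)), ?_, ?_, ?_⟩
    · have := h.2.2
      rw [r₃, r₄]
      have hv : (s₂.setMem (e.eval s.vars) (f.eval s.vars)).vars =
          s₂.vars.setMem (e.eval s.vars) (f.eval s.vars) := rfl
      rw [hv, v₂, v₁]
      exact this
    · exact a₁.trans (a₂.mono (by omega))
    · rw [r₃, r₄]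
      simp only [steps, Polynomial.eval_add, Polynomial.eval_C, Polynomial.eval_one, add_mul,
        one_mul]
      omega
  | seq c d ihc ihd =>
    intro k s Q h
    obtain ⟨s₁, t₁, x₁, q₁, a₁, b₁⟩ := ihc k s _ h
    obtain ⟨s₂, t₂, x₂, q₂, a₂, b₂⟩ := ihd k s₁ _ q₁
    refine ⟨_, _, .seq x₁ x₂, q₂, a₁.trans a₂, ?_⟩
    simp only [steps, Polynomial.eval_add, add_mul]
    omega
  | cond e c d ihc ihd =>
    intro k s Q h
    obtain ⟨s₁, t₁, x₁, v₁, r₁, a₁, b₁⟩ := e.exec_code k s h.1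
    have h1 := Nat.size_le_size h.1.eval_le
    by_cases h0 : e.eval s.vars = 0
    · obtain ⟨s₂, t₂, x₂, q₂, a₂, b₂⟩ := ihd k s₁ Q (v₁ ▸ h.2.2 h0)
      refine ⟨_, _, .seq x₁ (.ite_false (by rw [r₁, h0]) x₂), q₂, a₁.trans a₂, ?_⟩
      simp only [steps, Polynomial.eval_add, Polynomial.eval_C, Polynomial.eval_one, add_mul,
        one_mul, r₁]
      omega
    · obtain ⟨s₂, t₂, x₂, q₂, a₂, b₂⟩ := ihc k s₁ Q (v₁ ▸ h.2.1 h0)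
      refine ⟨_, _, .seq x₁ (.ite_true (by rwa [r₁]) x₂), q₂, a₁.trans a₂, ?_⟩
      simp only [steps, Polynomial.eval_add, Polynomial.eval_C, Polynomial.eval_one, add_mul,
        one_mul, r₁]
      omega
  | rep i e c ih =>
    intro k s Q h
    obtain ⟨s₁, t₁, x₁, v₁, r₁, a₁, b₁⟩ := e.exec_code k s h.1
    have h1 := Nat.size_le_size h.1.eval_le
    obtain ⟨hb, hN, I, hI, hstep, hQ⟩ := h
    set m := e.eval s.vars with hm
    set w := 1 + 2 * M.size with hw
    -- Induction on the number `l` of remaining rounds. The machine counts down in a scratch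
    -- register that the body, compiled one level higher, does not touch, while the variable `i`
    -- counts up. The `4` pays for the test and the three instructions that update the counters.
    have key : ∀ l j s, l + j = m → s.reg (2 * k + 1) = l → I j s.vars →
        ∃ s' t, Exec (.loop (2 * k + 1)
          (.seq (c.code (k + 1)) (.seq (.const (2 * (k + 1) + 1) 1)
            (.seq (.arith .add (2 * i) (2 * i) (2 * (k + 1) + 1))
              (.arith .sub (2 * k + 1) (2 * k + 1) (2 * (k + 1) + 1)))))) s s' t ∧
          I m s'.vars ∧ s.Agree k s' ∧ t ≤ l * ((c.steps.eval N + 4) * w) + w := by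
      intro l
      induction l with
      | zero =>
        intro j s hj hs hI
        refine ⟨_, _, .loop_end hs, ?_, fun _ _ => rfl, ?_⟩
        · rw [zero_add] at hj; exact hj ▸ hI
        · rw [hs]; simp [hw]
      | succ l ihl =>
        intro j s hj hs hI
        obtain ⟨s₂, t₂, x₂, ⟨hle, q₂⟩, a₂, b₂⟩ := ih (k + 1) s _ (hstep j (by omega) _ hI)
        have hle' : s₂.reg (2 * i) ≤ M := hle
        have r₂ : s₂.reg (2 * k + 1) = l + 1 := by rw [a₂ k (by omega), hs]
        have n1 : 2 * i ≠ 2 * (k + 1) + 1 := by omega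
        have n2 : 2 * k + 1 ≠ 2 * (k + 1) + 1 := by omega
        have n3 : 2 * k + 1 ≠ 2 * i := by omega
        have n4 : 2 * (k + 1) + 1 ≠ 2 * i := by omega
        obtain ⟨s₃, hs₃⟩ : ∃ s₃, s₃ = ((s₂.setReg (2 * (k + 1) + 1) 1).setReg (2 * i)
          (s₂.reg (2 * i) + 1)).setReg (2 * k + 1) l := ⟨_, rfl⟩
        have body : Exec (.seq (.const (2 * (k + 1) + 1) 1)
            (.seq (.arith .add (2 * i) (2 * i) (2 * (k + 1) + 1))
              (.arith .sub (2 * k + 1) (2 * k + 1) (2 * (k + 1) + 1)))) s₂ s₃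
            ((1 + (1 : ℕ).size) + ((1 + (s₂.reg (2 * i)).size + (1 : ℕ).size) +
              (1 + (l + 1).size + (1 : ℕ).size))) := by
          have e1 := Exec.const (2 * (k + 1) + 1) 1 s₂
          have e2 := Exec.arith .add (2 * i) (2 * i) (2 * (k + 1) + 1)
            (s₂.setReg (2 * (k + 1) + 1) 1)
          have e3 := Exec.arith .sub (2 * k + 1) (2 * k + 1) (2 * (k + 1) + 1)
            ((s₂.setReg (2 * (k + 1) + 1) 1).setReg (2 * i) (s₂.reg (2 * i) + 1))
          simp only [State.setReg, Function.update_of_ne n1, Function.update_of_ne n2,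
            Function.update_of_ne n3, Function.update_of_ne n4, Function.update_self,
            ArithOp.eval, r₂, Nat.add_sub_cancel] at e1 e2 e3 hs₃
          rw [hs₃]
          exact .seq e1 (.seq e2 e3)
        have v₃ : s₃.vars = s₂.vars.setReg i (s₂.vars.reg i + 1) := by
          rw [hs₃, State.vars_setReg_odd, State.vars_setReg_even, State.vars_setReg_odd]; rfl
        have r₃ : s₃.reg (2 * k + 1) = l := by simp [hs₃, State.setReg]
        have a₃ : s₂.Agree k s₃ := by
          rw [hs₃]
          exact ((State.agree_setReg _ fun j hj => by omega).trans
            (State.agree_setReg _ fun j hj => by omega)).trans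
            (State.agree_setReg _ fun j hj => by omega)
        obtain ⟨s₄, t₄, x₄, q₄, a₄, b₄⟩ := ihl (j + 1) s₃ (by omega) r₃ (v₃ ▸ q₂)
        refine ⟨s₄, _, .loop_step (by rw [hs]; omega) (.seq x₂ body) x₄, q₄,
          (a₂.mono (by omega)).trans (a₃.trans a₄), ?_⟩
        have hl : (l + 1).size ≤ M.size := (Nat.size_le_size (by omega)).trans h1
        have hi := Nat.size_le_size hle'
        rw [hs]
        have : (l + 1) * ((c.steps.eval N + 4) * w) =
          l * ((c.steps.eval N + 4) * w) + c.steps.eval N * w + 4 * w := by ring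
        omega
    have hne : 2 * k + 1 ≠ 2 * i := by omega
    obtain ⟨s₂, t₂, x₂, q₂, a₂, b₂⟩ := key m 0 (s₁.setReg (2 * i) 0) rfl
      (by rw [State.setReg]; simp only [Function.update_of_ne hne, r₁])
      (by rw [State.vars_setReg_even, v₁]; exact hI)
    refine ⟨s₂, _, .seq x₁ (.seq (.const _ _ _) x₂), hQ _ q₂, a₁.trans
      ((State.agree_setReg _ fun j hj => by omega).trans a₂), ?_⟩
    have h2 : m * ((c.steps.eval N + 4) * w) ≤ N * ((c.steps.eval N + 4) * w) :=
      Nat.mul_le_mul_right _ hN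
    simp only [steps, Polynomial.eval_add, Polynomial.eval_C, Polynomial.eval_ofNat,
      Polynomial.eval_mul, Polynomial.eval_X, add_mul, Nat.size_zero]
    rw [mul_assoc N]
    omega

end Cmd

/-! ### Rules for reasoning about commands -/

namespace Cmd

theorem wp_mono {M N : ℕ} (c : Cmd) : ∀ {Q Q' : State → Prop} {a : State},
    (∀ b, Q b → Q' b) → c.wp M N Q a → c.wp M N Q' a := by
  induction c with
  | skip => intro Q Q' a h; exact h a
  | set r e => intro Q Q' a h w; exact ⟨w.1, h _ w.2⟩
  | put e f => intro Q Q' a h w; exact ⟨w.1, w.2.1, h _ w.2.2⟩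
  | seq c d ihc ihd => intro Q Q' a h w; exact ihc (fun b hb => ihd h hb) w
  | cond e c d ihc ihd =>
    intro Q Q' a h w
    exact ⟨w.1, fun h0 => ihc h (w.2.1 h0), fun h0 => ihd h (w.2.2 h0)⟩
  | rep i e c ih =>
    intro Q Q' a h w
    obtain ⟨hb, hN, I, h0, hs, hQ⟩ := w
    exact ⟨hb, hN, I, h0, hs, fun b hI => h b (hQ b hI)⟩

theorem wp_seq {M N : ℕ} {c d : Cmd} {P Q : State → Prop} {a : State} (hc : c.wp M N P a)
    (hd : ∀ b, P b → d.wp M N Q b) : (c.seq d).wp M N Q a :=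
  c.wp_mono hd hc

/-- The loop rule for a loop whose body does not change the counter. -/
theorem wp_rep {M N i m : ℕ} {e : Ex} {c : Cmd} {a : State} (I : ℕ → State → Prop)
    (hb : e.Bdd M a) (he : e.eval a = m) (hm : m ≤ N) (h0 : I 0 (a.setReg i 0))
    (hs : ∀ j < m, ∀ b, I j b → b.reg i = j →
      c.wp M N (fun b' => b'.reg i = j ∧ I (j + 1) (b'.setReg i (j + 1))) b) :
    (rep i e c).wp M N (I m) a := by
  subst he
  refine ⟨hb, hm, fun j b => I j b ∧ b.reg i = j, ⟨h0, by simp [State.setReg]⟩, ?_,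
    fun b h => h.1⟩
  rintro j hj b ⟨hI, hi⟩
  refine c.wp_mono ?_ (hs j hj b hI hi)
  rintro b' ⟨h1, h2⟩
  have := hb.eval_le
  exact ⟨by omega, by rw [h1]; exact h2, by simp [State.setReg, h1]⟩

end Cmd

/-! ## The data of an instance, as they stand in the memory -/

/-- The first memory cell after the input. -/
def freeCell (n : ℕ) : ℕ := n * n + 4 * n + 1

section Data

variable (m : ℕ → ℕ) (n : ℕ)

/-- The entry of the adjacency matrix. -/
def adjEntry (v u : ℕ) : ℕ := m (1 + v * n + u)
/-- The numerator of a cost. -/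
def costNum (v : ℕ) : ℕ := m (1 + n * n + 2 * v)
/-- The denominator of a cost. -/
def costDen (v : ℕ) : ℕ := m (1 + n * n + 2 * v + 1)
/-- The numerator of a value of the fractional solution. -/
def valNum (v : ℕ) : ℕ := m (1 + n * n + 2 * n + 2 * v)
/-- The denominator of a value of the fractional solution. -/
def valDen (v : ℕ) : ℕ := m (1 + n * n + 2 * n + 2 * v + 1)
/-- The product of the denominators of the costs. -/
def prodDen : ℕ := ∏ v ∈ range n, costDen m n v
/-- The costs, multiplied by `prodDen`. -/
def scaledCost (v : ℕ) : ℕ := costNum m n v * (prodDen m n / costDen m n v)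
/-- The indicator function of the vertices of value at least `1 / (k + 1)`. -/
def heavy (k u : ℕ) : ℕ := if valDen m n u ≤ valNum m n u * (k + 1) then 1 else 0
/-- The vertex `w` is dominated by the set with indicator function `δ`. -/
def Dominated (δ : ℕ → ℕ) (w : ℕ) : Prop :=
  ∃ u < n, (u = w ∨ adjEntry m n w u ≠ 0) ∧ δ u = 1
/-- The cheapest scaled cost of a vertex that dominates `w`. -/
def price (w : ℕ) : ℕ := sInf {z | ∃ u < n, (u = w ∨ adjEntry m n w u ≠ 0) ∧ z = scaledCost m n u}
/-- The price of `w` if it is not dominated by the heavy vertices. -/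
def extraPrice (k w : ℕ) : ℕ := if Dominated m n (heavy m n k) w then 0 else price m n w
/-- The bound for the scaled cost of the set computed for the threshold `1 / (k + 1)`. -/
def roundCost (k : ℕ) : ℕ :=
  ∑ u ∈ range n, scaledCost m n u * heavy m n k u + ∑ w ∈ range n, extraPrice m n k w

/-- All numbers that the rounding program computes are at most `M`. -/
structure Bounds (M : ℕ) : Prop where
  addr : n * n + 20 * n + 20 ≤ M
  input : ∀ i < freeCell n, m i ≤ M
  den_pos : ∀ v < n, 0 < costDen m n v
  prod : prodDen m n ≤ M
  cost : ∑ v ∈ range n, scaledCost m n v < M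
  val : ∀ v < n, valNum m n v * (2 * n + 1) + 1 ≤ M

end Data

/-! ## The rounding program -/

namespace Ex

/-- Addition. -/
def add (e f : Ex) : Ex := op .add e f
/-- Truncated subtraction. -/
def sub (e f : Ex) : Ex := op .sub e f
/-- Multiplication. -/
def mul (e f : Ex) : Ex := op .mul e f
/-- The entry of the adjacency matrix. -/
def adjAt (v u : Ex) : Ex := get (add (add (lit 1) (mul v (var 0))) u)
/-- The numerator of a cost. -/
def costNumAt (v : Ex) : Ex := get (add (var 10) (mul (lit 2) v))
/-- The denominator of a cost. -/
def costDenAt (v : Ex) : Ex := get (add (add (var 10) (mul (lit 2) v)) (lit 1))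
/-- The numerator of a value. -/
def valNumAt (v : Ex) : Ex := get (add (add (var 10) (mul (lit 2) (var 0))) (mul (lit 2) v))
/-- The denominator of a value. -/
def valDenAt (v : Ex) : Ex :=
  get (add (add (add (var 10) (mul (lit 2) (var 0))) (mul (lit 2) v)) (lit 1))
/-- The address of a scaled cost. -/
def costAddr (v : Ex) : Ex := add (var 1) v
/-- The address of an entry of the current set. -/
def setAddr (v : Ex) : Ex := add (add (var 1) (var 0)) v
/-- The address of an entry of the best set so far. -/
def bestAddr (v : Ex) : Ex := add (add (var 1) (mul (lit 2) (var 0))) v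

end Ex

namespace Cmd

open Ex

/-- Computes the product of the denominators of the costs. -/
def prodLoop : Cmd := rep 2 (var 0) (set 4 (mul (var 4) (costDenAt (var 2))))

/-- Scales the costs. -/
def scaleLoop : Cmd :=
  rep 2 (var 0) (put (costAddr (var 2))
    (mul (costNumAt (var 2)) (op .div (var 4) (costDenAt (var 2)))))

/-- Puts the heavy vertices into the current set. -/
def heavyLoop : Cmd :=
  rep 3 (var 0) (cond
    (sub (add (mul (valNumAt (var 3)) (add (var 5) (lit 1))) (lit 1)) (valDenAt (var 3)))
    (put (setAddr (var 3)) (lit 1)) (put (setAddr (var 3)) (lit 0)))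

/-- Finds out whether a neighbour of a vertex is in the current set, and finds the cheapest vertex
that dominates it. -/
def scanLoop : Cmd :=
  rep 3 (var 0) (cond (adjAt (var 2) (var 3))
    (seq (set 6 (add (var 6) (get (setAddr (var 3)))))
      (cond (sub (get (costAddr (var 7))) (get (costAddr (var 3)))) (set 7 (var 3)) skip))
    skip)

/-- Adds a cheapest dominating vertex for each vertex that is not dominated. -/
def completeLoop : Cmd :=
  rep 2 (var 0) (seq (set 6 (lit 0)) (seq (set 7 (var 2)) (seq scanLoop
    (seq (set 6 (add (var 6) (get (setAddr (var 2)))))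
      (cond (var 6) skip (put (setAddr (var 7)) (lit 1)))))))

/-- Computes the cost of the current set. -/
def costLoop : Cmd :=
  seq (set 8 (lit 0)) (rep 3 (var 0)
    (set 8 (add (var 8) (mul (get (costAddr (var 3))) (get (setAddr (var 3)))))))

/-- Copies the current set to the best set. -/
def saveLoop : Cmd := rep 3 (var 0) (put (bestAddr (var 3)) (get (setAddr (var 3))))

/-- Keeps the current set if it is cheaper than the best set so far, or the first one. -/
def compareStep : Cmd :=
  cond (add (sub (var 9) (var 8)) (sub (lit 1) (var 5))) (seq (set 9 (var 8)) saveLoop) skip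

/-- Tries all thresholds. -/
def thresholdLoop : Cmd :=
  rep 5 (add (mul (lit 2) (var 0)) (lit 1))
    (seq heavyLoop (seq completeLoop (seq costLoop compareStep)))

/-- Writes the best set to the output cells. -/
def outputLoop : Cmd := rep 3 (var 0) (put (var 3) (get (bestAddr (var 3))))

/-- Initializes the variables. -/
def initStep : Cmd :=
  seq (set 0 (get (lit 0))) (seq (set 10 (add (lit 1) (mul (var 0) (var 0))))
    (seq (set 1 (add (var 10) (mul (lit 4) (var 0)))) (set 4 (lit 1))))

/-- The rounding program. -/
def rounding : Cmd :=
  seq initStep (seq prodLoop (seq scaleLoop (seq thresholdLoop outputLoop)))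

end Cmd

/-! ## Verification -/

section Verify

variable {m : ℕ → ℕ} {n : ℕ} {M N : ℕ}

/-- The variables for the number of vertices and the addresses of the arrays are set, and the input
still stands in the memory. -/
structure Fixed (m : ℕ → ℕ) (n : ℕ) (b : State) : Prop where
  num : b.reg 0 = n
  free : b.reg 1 = freeCell n
  vals : b.reg 10 = 1 + n * n
  input : ∀ i < freeCell n, b.mem i = m i

theorem Fixed.setReg {b : State} (h : Fixed m n b) {r : ℕ} (h0 : r ≠ 0) (h1 : r ≠ 1)
    (h2 : r ≠ 10) (c : ℕ) : Fixed m n (b.setReg r c) where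
  num := by simp [State.setReg, h0.symm, h.num]
  free := by simp [State.setReg, h1.symm, h.free]
  vals := by simp [State.setReg, h2.symm, h.vals]
  input := h.input

theorem Fixed.setMem {b : State} (h : Fixed m n b) {i : ℕ} (hi : freeCell n ≤ i) (c : ℕ) :
    Fixed m n (b.setMem i c) where
  num := h.num
  free := h.free
  vals := h.vals
  input j hj := by
    rw [← h.input j hj]
    exact Function.update_of_ne (by omega) _ _

/-! ### Values and size bounds of memory accesses -/

section Reads

open Ex

variable {b : State} {e f : Ex}

theorem Fixed.eval_adjAt (h : Fixed m n b) (he : e.eval b < n) (hf : f.eval b < n) :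
    (adjAt e f).eval b = adjEntry m n (e.eval b) (f.eval b) := by
  have : e.eval b * n + n ≤ n * n := by nlinarith
  simp only [adjAt, add, mul, Ex.eval, ArithOp.eval, h.num]
  rw [h.input _ (by unfold freeCell; omega)]
  rfl

theorem Fixed.bdd_adjAt (h : Fixed m n b) (hB : Bounds m n M) (he : e.eval b < n)
    (hf : f.eval b < n) (he' : e.Bdd M b) (hf' : f.Bdd M b) : (adjAt e f).Bdd M b := by
  have h1 : e.eval b * n + n ≤ n * n := by nlinarith
  have h2 := hB.addr
  have h3 := hB.input (1 + e.eval b * n + f.eval b) (by unfold freeCell; omega)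
  have h4 := h.eval_adjAt he hf
  refine ⟨⟨⟨?_, ⟨he', ?_, ?_⟩, ?_⟩, hf', ?_⟩, ?_⟩
  · change 1 ≤ M; omega
  · change b.reg 0 ≤ M; rw [h.num]; omega
  · change e.eval b * b.reg 0 ≤ M; rw [h.num]; omega
  · change 1 + e.eval b * b.reg 0 ≤ M; rw [h.num]; omega
  · change 1 + e.eval b * b.reg 0 + f.eval b ≤ M; rw [h.num]; omega
  · exact h4.trans_le h3

theorem Fixed.eval_costNumAt (h : Fixed m n b) (he : e.eval b < n) :
    (costNumAt e).eval b = costNum m n (e.eval b) := by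
  simp only [costNumAt, add, mul, Ex.eval, ArithOp.eval, h.vals]
  rw [h.input _ (by unfold freeCell; omega)]
  rfl

theorem Fixed.eval_costDenAt (h : Fixed m n b) (he : e.eval b < n) :
    (costDenAt e).eval b = costDen m n (e.eval b) := by
  simp only [costDenAt, add, mul, Ex.eval, ArithOp.eval, h.vals]
  rw [h.input _ (by unfold freeCell; omega)]
  rfl

theorem Fixed.eval_valNumAt (h : Fixed m n b) (he : e.eval b < n) :
    (valNumAt e).eval b = valNum m n (e.eval b) := by
  simp only [valNumAt, add, mul, Ex.eval, ArithOp.eval, h.vals, h.num]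
  rw [h.input _ (by unfold freeCell; omega)]
  rfl

theorem Fixed.eval_valDenAt (h : Fixed m n b) (he : e.eval b < n) :
    (valDenAt e).eval b = valDen m n (e.eval b) := by
  simp only [valDenAt, add, mul, Ex.eval, ArithOp.eval, h.vals, h.num]
  rw [h.input _ (by unfold freeCell; omega)]
  rfl

theorem Fixed.bdd_costNumAt (h : Fixed m n b) (hB : Bounds m n M) (he : e.eval b < n)
    (he' : e.Bdd M b) : (costNumAt e).Bdd M b := by
  have h2 := hB.addr
  have h3 := hB.input (1 + n * n + 2 * e.eval b) (by unfold freeCell; omega)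
  have h4 := h.eval_costNumAt he
  refine ⟨⟨?_, ⟨?_, he', ?_⟩, ?_⟩, h4.trans_le h3⟩ <;>
    simp only [Ex.Bdd, mul, Ex.eval, ArithOp.eval, h.vals] <;> omega

theorem Fixed.bdd_costDenAt (h : Fixed m n b) (hB : Bounds m n M) (he : e.eval b < n)
    (he' : e.Bdd M b) : (costDenAt e).Bdd M b := by
  have h2 := hB.addr
  have h3 := hB.input (1 + n * n + 2 * e.eval b + 1) (by unfold freeCell; omega)
  have h4 := h.eval_costDenAt he
  refine ⟨⟨⟨?_, ⟨?_, he', ?_⟩, ?_⟩, ?_, ?_⟩, h4.trans_le h3⟩ <;>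
    simp only [Ex.Bdd, add, mul, Ex.eval, ArithOp.eval, h.vals] <;> omega

theorem Fixed.bdd_valNumAt (h : Fixed m n b) (hB : Bounds m n M) (he : e.eval b < n)
    (he' : e.Bdd M b) : (valNumAt e).Bdd M b := by
  have h2 := hB.addr
  have h3 := hB.input (1 + n * n + 2 * n + 2 * e.eval b) (by unfold freeCell; omega)
  have h4 := h.eval_valNumAt he
  refine ⟨⟨⟨?_, ⟨?_, ?_, ?_⟩, ?_⟩, ⟨?_, he', ?_⟩, ?_⟩, h4.trans_le h3⟩ <;>
    simp only [Ex.Bdd, add, mul, Ex.eval, ArithOp.eval, h.vals, h.num] <;> omega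

theorem Fixed.bdd_valDenAt (h : Fixed m n b) (hB : Bounds m n M) (he : e.eval b < n)
    (he' : e.Bdd M b) : (valDenAt e).Bdd M b := by
  have h2 := hB.addr
  have h3 := hB.input (1 + n * n + 2 * n + 2 * e.eval b + 1) (by unfold freeCell; omega)
  have h4 := h.eval_valDenAt he
  refine ⟨⟨⟨⟨?_, ⟨?_, ?_, ?_⟩, ?_⟩, ⟨?_, he', ?_⟩, ?_⟩, ?_, ?_⟩, h4.trans_le h3⟩ <;>
    simp only [Ex.Bdd, add, mul, Ex.eval, ArithOp.eval, h.vals, h.num] <;> omega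

theorem Fixed.eval_costAddr (h : Fixed m n b) :
    (costAddr e).eval b = freeCell n + e.eval b := by
  simp only [costAddr, add, Ex.eval, ArithOp.eval, h.free]

theorem Fixed.eval_setAddr (h : Fixed m n b) :
    (setAddr e).eval b = freeCell n + n + e.eval b := by
  simp only [setAddr, add, Ex.eval, ArithOp.eval, h.free, h.num]

theorem Fixed.eval_bestAddr (h : Fixed m n b) :
    (bestAddr e).eval b = freeCell n + 2 * n + e.eval b := by
  simp only [bestAddr, add, mul, Ex.eval, ArithOp.eval, h.free, h.num]

theorem Fixed.bdd_costAddr (h : Fixed m n b) (hB : Bounds m n M) (he : e.eval b < n)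
    (he' : e.Bdd M b) : (costAddr e).Bdd M b := by
  have h2 := hB.addr
  refine ⟨?_, he', ?_⟩ <;>
    simp only [Ex.Bdd, Ex.eval, ArithOp.eval, h.free, freeCell] <;> omega

theorem Fixed.bdd_setAddr (h : Fixed m n b) (hB : Bounds m n M) (he : e.eval b < n)
    (he' : e.Bdd M b) : (setAddr e).Bdd M b := by
  have h2 := hB.addr
  refine ⟨⟨?_, ?_, ?_⟩, he', ?_⟩ <;>
    simp only [Ex.Bdd, add, Ex.eval, ArithOp.eval, h.free, h.num, freeCell] <;> omega

theorem Fixed.bdd_bestAddr (h : Fixed m n b) (hB : Bounds m n M) (he : e.eval b < n)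
    (he' : e.Bdd M b) : (bestAddr e).Bdd M b := by
  have h2 := hB.addr
  refine ⟨⟨?_, ⟨?_, ?_, ?_⟩, ?_⟩, he', ?_⟩ <;>
    simp only [Ex.Bdd, add, mul, Ex.eval, ArithOp.eval, h.free, h.num, freeCell] <;> omega

end Reads

theorem Fixed.bdd_num {b : State} (h : Fixed m n b) (hB : Bounds m n M) :
    (Ex.var 0).Bdd M b := by
  have := hB.addr
  change b.reg 0 ≤ M
  rw [h.num]; omega

/-! ### Correctness of the loops of the rounding program -/

theorem wp_prodLoop (hB : Bounds m n M) (hN : 2 * n + 1 ≤ N) {a : State} (hF : Fixed m n a)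
    (hq : a.reg 4 = 1) :
    Cmd.prodLoop.wp M N (fun b => Fixed m n b ∧ b.reg 4 = prodDen m n ∧ b.reg 9 = a.reg 9) a := by
  refine Cmd.wp_rep (fun j b => Fixed m n b ∧ b.reg 4 = ∏ v ∈ range j, costDen m n v ∧
    b.reg 9 = a.reg 9) (hF.bdd_num hB) hF.num (by omega) ?_ ?_
  · exact ⟨hF.setReg (by decide) (by decide) (by decide) 0, by simp [State.setReg, hq],
      by simp [State.setReg]⟩
  · rintro j hj b ⟨hF, hq, h9⟩ hi
    have he : (Ex.var 2).eval b = j := hi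
    have hlt : (Ex.var 2).eval b < n := by omega
    have hM := hB.addr
    -- The denominators are positive, so no partial product exceeds the full product.
    have hle : ∀ i ≤ n, ∏ v ∈ range i, costDen m n v ≤ M := fun i hi' =>
      (Finset.prod_le_prod_of_subset_of_one_le' (range_subset_range.2 hi') fun v hv _ =>
        hB.den_pos v (mem_range.1 hv)).trans hB.prod
    have hval : (Ex.mul (.var 4) (.costDenAt (.var 2))).eval b =
        ∏ v ∈ range (j + 1), costDen m n v := by
      rw [prod_range_succ, ← hq, ← he, ← hF.eval_costDenAt hlt]; rfl
    refine ⟨⟨?_, hF.bdd_costDenAt hB hlt ?_, ?_⟩, ?_, ?_, ?_⟩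
    · change b.reg 4 ≤ M; rw [hq]; exact hle j (by omega)
    · change b.reg 2 ≤ M; omega
    · exact hval.trans_le (hle _ (by omega))
    · simp [State.setReg, hi]
    · exact (hF.setReg (by decide) (by decide) (by decide) _).setReg (by decide) (by decide)
        (by decide) _
    · exact ⟨by simpa [State.setReg] using hval, by simpa [State.setReg] using h9⟩

theorem scaledCost_le (hB : Bounds m n M) {v : ℕ} (hv : v < n) : scaledCost m n v ≤ M :=
  (single_le_sum (f := scaledCost m n) (fun _ _ => Nat.zero_le _) (mem_range.2 hv)).trans hB.cost.le

theorem wp_scaleLoop (hB : Bounds m n M) (hN : 2 * n + 1 ≤ N) {a : State} (hF : Fixed m n a)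
    (hq : a.reg 4 = prodDen m n) :
    Cmd.scaleLoop.wp M N (fun b => Fixed m n b ∧
      (∀ v < n, b.mem (freeCell n + v) = scaledCost m n v) ∧ b.reg 9 = a.reg 9) a := by
  refine Cmd.wp_mono _ (fun b hb => ⟨hb.1, hb.2.2.1, hb.2.2.2⟩) (Cmd.wp_rep
    (fun j b => Fixed m n b ∧ b.reg 4 = prodDen m n ∧
      (∀ v < j, b.mem (freeCell n + v) = scaledCost m n v) ∧ b.reg 9 = a.reg 9)
    (hF.bdd_num hB) hF.num (by omega) ?_ ?_)
  · exact ⟨hF.setReg (by decide) (by decide) (by decide) 0, by simp [State.setReg, hq],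
      by simp, by simp [State.setReg]⟩
  · rintro j hj b ⟨hF, hq, hc, h9⟩ hi
    have he : (Ex.var 2).eval b = j := hi
    have hlt : (Ex.var 2).eval b < n := by omega
    have hM := hB.addr
    have hbd : (Ex.var 2).Bdd M b := by change b.reg 2 ≤ M; omega
    have hdiv : (Ex.op .div (.var 4) (.costDenAt (.var 2))).eval b =
        prodDen m n / costDen m n j := by
      rw [← hq, ← he, ← hF.eval_costDenAt hlt]; rfl
    have hval : (Ex.mul (.costNumAt (.var 2))
        (.op .div (.var 4) (.costDenAt (.var 2)))).eval b = scaledCost m n j := by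
      rw [scaledCost, ← hdiv, ← he, ← hF.eval_costNumAt hlt]; rfl
    refine ⟨hF.bdd_costAddr hB hlt hbd, ⟨hF.bdd_costNumAt hB hlt hbd,
      ⟨?_, hF.bdd_costDenAt hB hlt hbd, ?_⟩, ?_⟩, hi, ?_, hq, ?_, h9⟩
    · change b.reg 4 ≤ M; rw [hq]; exact hB.prod
    · exact hdiv.trans_le ((Nat.div_le_self _ _).trans hB.prod)
    · exact hval.trans_le (scaledCost_le hB hj)
    · refine (hF.setMem ?_ _).setReg (by decide) (by decide) (by decide) _
      rw [hF.eval_costAddr]; omega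
    · intro v hv
      change Function.update b.mem _ _ _ = _
      rw [hF.eval_costAddr, hval, he]
      by_cases hvj : v = j
      · subst hvj; simp
      · rw [Function.update_of_ne (by omega)]; exact hc v (by omega)

/-- The context of the rounding for the threshold `1 / (k + 1)`: the scaled costs are known, and
`ε` is the best set so far. -/
structure Ctx (m : ℕ → ℕ) (n k best : ℕ) (ε : ℕ → ℕ) (b : State) : Prop extends Fixed m n b where
  costs : ∀ v < n, b.mem (freeCell n + v) = scaledCost m n v
  thr : b.reg 5 = k
  bst : b.reg 9 = best
  saved : ∀ u < n, b.mem (freeCell n + 2 * n + u) = ε u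

/-- `δ` is the current set. -/
def Current (n : ℕ) (δ : ℕ → ℕ) (b : State) : Prop := ∀ u < n, b.mem (freeCell n + n + u) = δ u

variable {k best : ℕ} {ε δ : ℕ → ℕ}

theorem Ctx.setReg {b : State} (h : Ctx m n k best ε b) {r : ℕ} (c : ℕ)
    (hr : r ∉ ({0, 1, 10, 5, 9} : Finset ℕ)) : Ctx m n k best ε (b.setReg r c) := by
  simp only [mem_insert, mem_singleton, not_or] at hr
  exact
    { h.toFixed.setReg hr.1 hr.2.1 hr.2.2.1 c with
      costs := h.costs
      thr := by simp [State.setReg, Ne.symm hr.2.2.2.1, h.thr]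
      bst := by simp [State.setReg, Ne.symm hr.2.2.2.2, h.bst]
      saved := h.saved }

theorem Ctx.setMem {b : State} (h : Ctx m n k best ε b) {u : ℕ} (hu : u < n) (c : ℕ) :
    Ctx m n k best ε (b.setMem (freeCell n + n + u) c) :=
  { h.toFixed.setMem (by omega) c with
    costs := fun v hv => (Function.update_of_ne (by omega) _ _).trans (h.costs v hv)
    thr := h.thr
    bst := h.bst
    saved := fun v hv => (Function.update_of_ne (by omega) _ _).trans (h.saved v hv) }

theorem Ctx.eval_cost {b : State} (h : Ctx m n k best ε b) {e : Ex} (he : e.eval b < n) :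
    (Ex.get (.costAddr e)).eval b = scaledCost m n (e.eval b) := by
  change b.mem (Ex.eval b _) = _
  rw [h.eval_costAddr, h.costs _ he]

theorem Ctx.bdd_cost {b : State} (h : Ctx m n k best ε b) (hB : Bounds m n M) {e : Ex}
    (he : e.eval b < n) (he' : e.Bdd M b) : (Ex.get (.costAddr e)).Bdd M b :=
  ⟨h.bdd_costAddr hB he he', (h.eval_cost he).trans_le (scaledCost_le hB he)⟩

theorem Current.eval {b : State} (h : Current n δ b) (hF : Fixed m n b) {e : Ex}
    (he : e.eval b < n) : (Ex.get (.setAddr e)).eval b = δ (e.eval b) := by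
  change b.mem (Ex.eval b _) = _
  rw [hF.eval_setAddr, h _ he]

theorem Current.bdd {b : State} (h : Current n δ b) (hF : Fixed m n b) (hB : Bounds m n M)
    (hδ : ∀ u, δ u ≤ 1) {e : Ex} (he : e.eval b < n) (he' : e.Bdd M b) :
    (Ex.get (.setAddr e)).Bdd M b := by
  have := hB.addr
  exact ⟨hF.bdd_setAddr hB he he', (h.eval hF he).trans_le ((hδ _).trans (by omega))⟩

theorem heavy_le (u : ℕ) : heavy m n k u ≤ 1 := by unfold heavy; split_ifs <;> simp

theorem wp_heavyLoop (hB : Bounds m n M) (hN : 2 * n + 1 ≤ N) (hk : k < 2 * n + 1) {a : State}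
    (hC : Ctx m n k best ε a) :
    Cmd.heavyLoop.wp M N (fun b => Ctx m n k best ε b ∧ Current n (heavy m n k) b) a := by
  refine Cmd.wp_rep (fun j b => Ctx m n k best ε b ∧
    ∀ u < j, b.mem (freeCell n + n + u) = heavy m n k u)
    (hC.bdd_num hB) hC.num (by omega) ⟨hC.setReg 0 (by decide), by simp⟩ ?_
  rintro j hj b ⟨hC, hc⟩ hi
  have he : (Ex.var 3).eval b = j := hi
  have hlt : (Ex.var 3).eval b < n := by omega
  have hM := hB.addr
  have hbd : (Ex.var 3).Bdd M b := by change b.reg 3 ≤ M; omega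
  have hmul : (Ex.mul (.valNumAt (.var 3)) (.add (.var 5) (.lit 1))).eval b =
      valNum m n j * (k + 1) := by
    rw [← hC.thr, ← he, ← hC.eval_valNumAt hlt]; rfl
  have hadd : (Ex.add (.mul (.valNumAt (.var 3)) (.add (.var 5) (.lit 1))) (.lit 1)).eval b =
      valNum m n j * (k + 1) + 1 := by rw [← hmul]; rfl
  -- Because of the added `1`, the truncated difference is nonzero exactly if the denominator is at
  -- most `k + 1` times the numerator, that is, if the value is at least `1 / (k + 1)`.
  have hsub : (Ex.sub (.add (.mul (.valNumAt (.var 3)) (.add (.var 5) (.lit 1))) (.lit 1))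
      (.valDenAt (.var 3))).eval b = valNum m n j * (k + 1) + 1 - valDen m n j := by
    rw [← hadd, ← he, ← hC.eval_valDenAt hlt]; rfl
  have hle : valNum m n j * (k + 1) + 1 ≤ M :=
    (Nat.add_le_add_right (Nat.mul_le_mul_left _ (by omega)) 1).trans (hB.val j hj)
  have hthr := hC.thr
  have key : ∀ c ≤ 1, heavy m n k j = c →
      (Cmd.put (.setAddr (.var 3)) (.lit c)).wp M N (fun b' => b'.reg 3 = j ∧
        (Ctx m n k best ε (b'.setReg 3 (j + 1)) ∧ ∀ u < j + 1,
          (b'.setReg 3 (j + 1)).mem (freeCell n + n + u) = heavy m n k u)) b := by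
    intro c hc1 hh
    refine ⟨hC.bdd_setAddr hB hlt hbd, (by change c ≤ M; omega), hi, ?_, ?_⟩
    · rw [hC.eval_setAddr, he]
      exact (hC.setMem hj _).setReg _ (by decide)
    · intro u hu
      change Function.update b.mem _ _ _ = _
      rw [hC.eval_setAddr, he]
      by_cases huj : u = j
      · subst huj; simp [hh, Ex.eval]
      · rw [Function.update_of_ne (by omega)]; exact hc u (by omega)
  refine ⟨⟨⟨⟨hC.bdd_valNumAt hB hlt hbd, ⟨?_, ?_, ?_⟩, ?_⟩, ?_, ?_⟩,
    hC.bdd_valDenAt hB hlt hbd, ?_⟩, fun h => ?_, fun h => ?_⟩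
  · change b.reg 5 ≤ M; omega
  · change 1 ≤ M; omega
  · change b.reg 5 + 1 ≤ M; omega
  · exact hmul.trans_le (by omega)
  · change 1 ≤ M; omega
  · exact hadd.trans_le hle
  · exact hsub.trans_le (by omega)
  · rw [hsub] at h
    exact key 1 le_rfl (if_pos (by omega))
  · rw [hsub] at h
    exact key 0 (by omega) (if_neg (by omega))

/-- The state of the search for a cheapest dominating vertex of `v` after the first `j` vertices. -/
structure Scan (m : ℕ → ℕ) (n : ℕ) (δ : ℕ → ℕ) (v j : ℕ) (b : State) : Prop where
  vertex : b.reg 2 = v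
  flag_le : b.reg 6 ≤ j
  flag : b.reg 6 ≠ 0 ↔ ∃ u < j, adjEntry m n v u ≠ 0 ∧ δ u = 1
  lt : b.reg 7 < n
  nbr : b.reg 7 = v ∨ adjEntry m n v (b.reg 7) ≠ 0
  self : scaledCost m n (b.reg 7) ≤ scaledCost m n v
  cheap : ∀ u < j, adjEntry m n v u ≠ 0 → scaledCost m n (b.reg 7) ≤ scaledCost m n u

/-- The search starts with `v` itself as the cheapest candidate, so only neighbours have to be
scanned. Variable 6 counts the neighbours that are in the current set; whether `v` is in it is left
to the caller. -/
theorem wp_scanLoop (hB : Bounds m n M) (hN : 2 * n + 1 ≤ N) (hδ : ∀ u, δ u ≤ 1) {v : ℕ}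
    (hv : v < n) {a : State} (hC : Ctx m n k best ε a) (hD : Current n δ a)
    (h2 : a.reg 2 = v) (h6 : a.reg 6 = 0) (h7 : a.reg 7 = v) :
    Cmd.scanLoop.wp M N (fun b => Ctx m n k best ε b ∧ Current n δ b ∧ Scan m n δ v n b) a := by
  refine Cmd.wp_rep (fun j b => Ctx m n k best ε b ∧ Current n δ b ∧ Scan m n δ v j b)
    (hC.bdd_num hB) hC.num (by omega) ⟨hC.setReg 0 (by decide), hD, ?_⟩ ?_
  · constructor <;> simp [State.setReg, h2, h6, h7, hv]
  rintro j hj b ⟨hC, hD, hS⟩ hi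
  have he : (Ex.var 3).eval b = j := hi
  have he2 : (Ex.var 2).eval b = v := hS.vertex
  have hlt : (Ex.var 3).eval b < n := by omega
  have hlt2 : (Ex.var 2).eval b < n := by omega
  have hM := hB.addr
  have hbd : (Ex.var 3).Bdd M b := by change b.reg 3 ≤ M; omega
  have hbd2 : (Ex.var 2).Bdd M b := by change b.reg 2 ≤ M; have := hS.vertex; omega
  have hfl := hS.flag_le
  have hδj := hδ j
  refine ⟨hC.bdd_adjAt hB hlt2 hlt hbd2 hbd, fun h => ?_, fun h => ?_⟩
  · rw [hC.eval_adjAt hlt2 hlt, he, he2] at h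
    have hsum : (Ex.add (.var 6) (.get (.setAddr (.var 3)))).eval b = b.reg 6 + δ j := by
      rw [← he, ← hD.eval hC.toFixed hlt]; rfl
    refine ⟨⟨?_, hD.bdd hC.toFixed hB hδ hlt hbd, ?_⟩, ?_⟩
    · change b.reg 6 ≤ M; omega
    · exact hsum.trans_le (by omega)
    rw [hsum]
    set b₁ := b.setReg 6 (b.reg 6 + δ j) with hb₁
    have hC₁ : Ctx m n k best ε b₁ := hC.setReg _ (by decide)
    have r6 : b₁.reg 6 = b.reg 6 + δ j := by simp [hb₁, State.setReg]
    have r7 : b₁.reg 7 = b.reg 7 := by simp [hb₁, State.setReg]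
    have r3 : b₁.reg 3 = j := by simp [hb₁, State.setReg, hi]
    have r2 : b₁.reg 2 = v := by simp [hb₁, State.setReg, hS.vertex]
    have hD₁ : Current n δ b₁ := hD
    have hflag : b.reg 6 + δ j ≠ 0 ↔ ∃ u < j + 1, adjEntry m n v u ≠ 0 ∧ δ u = 1 := by
      constructor
      · intro h0
        by_cases h1 : b.reg 6 = 0
        · exact ⟨j, by omega, h, by omega⟩
        · obtain ⟨u, hu, hu'⟩ := hS.flag.1 h1
          exact ⟨u, by omega, hu'⟩
      · rintro ⟨u, hu, hu1, hu2⟩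
        by_cases huj : u = j
        · subst huj; omega
        · have := hS.flag.2 ⟨u, by omega, hu1, hu2⟩; omega
    have hlt3 : (Ex.var 3).eval b₁ < n := by change b₁.reg 3 < n; omega
    have hlt7 : (Ex.var 7).eval b₁ < n := by change b₁.reg 7 < n; rw [r7]; exact hS.lt
    have hbd3 : (Ex.var 3).Bdd M b₁ := by change b₁.reg 3 ≤ M; omega
    have hbd7 : (Ex.var 7).Bdd M b₁ := by change b₁.reg 7 ≤ M; have := hS.lt; omega
    have hsub : (Ex.sub (.get (.costAddr (.var 7))) (.get (.costAddr (.var 3)))).eval b₁ =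
        scaledCost m n (b.reg 7) - scaledCost m n j := by
      rw [← r7, ← r3]
      exact congrArg₂ (· - ·) (hC₁.eval_cost hlt7) (hC₁.eval_cost hlt3)
    have hself := scaledCost_le hB hS.lt
    refine ⟨⟨hC₁.bdd_cost hB hlt7 hbd7, hC₁.bdd_cost hB hlt3 hbd3,
      hsub.trans_le (by omega)⟩, fun h0 => ?_, fun h0 => ?_⟩
    · rw [hsub] at h0
      refine ⟨hbd3, ?_, (hC₁.setReg _ (by decide)).setReg _ (by decide), hD₁, ?_⟩
      · simpa [State.setReg] using r3
      · have hself := hS.self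
        constructor <;> simp only [State.setReg, Ex.eval, r3, r6, r2, Function.update_self, ne_eq, not_false_eq_true, Function.update_of_ne, Nat.reduceEqDiff]
        · omega
        · exact hflag
        · exact hj
        · exact .inr h
        · omega
        · intro u hu hu'
          by_cases huj : u = j
          · rw [huj]
          · have := hS.cheap u (by omega) hu'; omega
    · rw [hsub] at h0
      refine ⟨r3, hC₁.setReg _ (by decide), hD₁, ?_⟩
      constructor <;> simp only [State.setReg, r6, r2, r7, ne_eq, not_false_eq_true, Function.update_of_ne, Nat.reduceEqDiff]
      · omega
      · exact hflag
      · exact hS.lt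
      · exact hS.nbr
      · exact hS.self
      · intro u hu hu'
        by_cases huj : u = j
        · rw [huj]; omega
        · exact hS.cheap u (by omega) hu'
  · rw [hC.eval_adjAt hlt2 hlt, he, he2] at h
    refine ⟨hi, hC.setReg _ (by decide), hD, ?_⟩
    constructor <;> simp only [State.setReg, ne_eq, not_false_eq_true, Function.update_of_ne, Nat.reduceEqDiff]
    · exact hS.vertex
    · omega
    · refine hS.flag.trans ⟨fun ⟨u, hu, hu'⟩ => ⟨u, by omega, hu'⟩, fun ⟨u, hu, hu'⟩ => ?_⟩
      have : u ≠ j := by rintro rfl; exact hu'.1 h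
      exact ⟨u, by omega, hu'⟩
    · exact hS.lt
    · exact hS.nbr
    · exact hS.self
    · intro u hu hu'
      have : u ≠ j := by rintro rfl; exact hu' h
      exact hS.cheap u (by omega) hu'

theorem le_price {v g : ℕ} (hv : v < n)
    (hself : scaledCost m n g ≤ scaledCost m n v)
    (h : ∀ u < n, adjEntry m n v u ≠ 0 → scaledCost m n g ≤ scaledCost m n u) :
    scaledCost m n g ≤ price m n v := by
  obtain ⟨u, hu, hu', hz⟩ := Nat.sInf_mem
    (s := {z | ∃ u < n, (u = v ∨ adjEntry m n v u ≠ 0) ∧ z = scaledCost m n u})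
    ⟨_, v, hv, .inl rfl, rfl⟩
  rw [price, hz]
  rcases hu' with rfl | hu'
  exacts [hself, h u hu hu']

/-- The current set after the completion of the heavy vertices for the first `j` vertices. -/
structure Completed (m : ℕ → ℕ) (n k j : ℕ) (δ : ℕ → ℕ) : Prop where
  le_one : ∀ u, δ u ≤ 1
  heavy_le : ∀ u, heavy m n k u ≤ δ u
  dom : ∀ w < j, Dominated m n δ w
  cost : ∑ u ∈ range n, scaledCost m n u * δ u ≤
    ∑ u ∈ range n, scaledCost m n u * heavy m n k u + ∑ w ∈ range j, extraPrice m n k w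

theorem Dominated.mono {δ δ' : ℕ → ℕ} (h : ∀ u, δ u ≤ δ' u) (h' : ∀ u, δ' u ≤ 1) {w : ℕ}
    (hd : Dominated m n δ w) : Dominated m n δ' w := by
  obtain ⟨u, hu, hu', h1⟩ := hd
  have h2 := h u
  have h3 := h' u
  exact ⟨u, hu, hu', by omega⟩

theorem Completed.step_dominated {j : ℕ} (h : Completed m n k j δ) (hd : Dominated m n δ j) :
    Completed m n k (j + 1) δ where
  le_one := h.le_one
  heavy_le := h.heavy_le
  dom w hw := by
    rcases Nat.lt_succ_iff_lt_or_eq.1 hw with hw | rfl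
    exacts [h.dom w hw, hd]
  cost := by
    rw [sum_range_succ]
    exact h.cost.trans (by omega)

/-- A vertex not dominated by the current set is not dominated by the smaller set of heavy vertices
either, so its price is already part of the bound. Vertices added earlier can only save later
additions. -/
theorem Completed.step_add {j g : ℕ} (h : Completed m n k j δ) (hd : ¬ Dominated m n δ j)
    (hg : g < n) (hnbr : g = j ∨ adjEntry m n j g ≠ 0)
    (hp : scaledCost m n g ≤ price m n j) :
    Completed m n k (j + 1) (Function.update δ g 1) := by
  have hle : ∀ u, δ u ≤ Function.update δ g 1 u := fun u => by
    rcases eq_or_ne u g with rfl | hu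
    · simpa using h.le_one u
    · rw [Function.update_of_ne hu]
  have hle1 : ∀ u, Function.update δ g 1 u ≤ 1 := fun u => by
    rcases eq_or_ne u g with rfl | hu
    · simp
    · rw [Function.update_of_ne hu]; exact h.le_one u
  refine ⟨hle1, fun u => (h.heavy_le u).trans (hle u), fun w hw => ?_, ?_⟩
  · rcases Nat.lt_succ_iff_lt_or_eq.1 hw with hw | rfl
    · exact (h.dom w hw).mono hle hle1
    · exact ⟨g, hg, hnbr, by simp⟩
  · have hx : extraPrice m n k j = price m n j :=
      if_neg fun h' => hd (h'.mono h.heavy_le h.le_one)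
    rw [sum_range_succ, hx]
    have hsum : ∑ u ∈ range n, scaledCost m n u * Function.update δ g 1 u ≤
        ∑ u ∈ range n, scaledCost m n u * δ u + scaledCost m n g := by
      have : ∑ u ∈ range n, (if u = g then scaledCost m n u else 0) = scaledCost m n g := by
        rw [sum_ite_eq' (range n) g, if_pos (mem_range.2 hg)]
      rw [← this, ← sum_add_distrib]
      refine sum_le_sum fun u _ => ?_
      rcases eq_or_ne u g with rfl | hu
      · simp
      · rw [Function.update_of_ne hu]; simp
    have := h.cost
    omega

theorem wp_completeLoop (hB : Bounds m n M) (hN : 2 * n + 1 ≤ N) {a : State}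
    (hC : Ctx m n k best ε a) (hD : Current n (heavy m n k) a) :
    Cmd.completeLoop.wp M N (fun b => Ctx m n k best ε b ∧
      ∃ δ, Current n δ b ∧ Completed m n k n δ) a := by
  refine Cmd.wp_rep (fun j b => Ctx m n k best ε b ∧ ∃ δ, Current n δ b ∧ Completed m n k j δ)
    (hC.bdd_num hB) hC.num (by omega) ⟨hC.setReg 0 (by decide), _, hD, ?_⟩ ?_
  · exact ⟨heavy_le, fun u => le_rfl, by simp, by simp⟩
  rintro j hj b ⟨hC, δ, hD, hδ⟩ hi
  have hM := hB.addr
  refine ⟨Nat.zero_le _, ?_, ?_⟩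
  · change b.reg 2 ≤ M; omega
  refine Cmd.wp_seq (wp_scanLoop hB hN hδ.le_one hj ((hC.setReg _ (by decide)).setReg _
    (by decide)) (δ := δ) hD ?_ ?_ ?_) ?_
  · simp [State.setReg, hi]
  · simp [State.setReg, Ex.eval]
  · simp [State.setReg, Ex.eval, hi]
  rintro b ⟨hC, hD, hS⟩
  have he2 : (Ex.var 2).eval b = j := hS.vertex
  have hlt2 : (Ex.var 2).eval b < n := by omega
  have hbd2 : (Ex.var 2).Bdd M b := by change b.reg 2 ≤ M; have := hS.vertex; omega
  have hsum : (Ex.add (.var 6) (.get (.setAddr (.var 2)))).eval b = b.reg 6 + δ j := by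
    rw [← he2, ← hD.eval hC.toFixed hlt2]; rfl
  have hfl := hS.flag_le
  have hδj := hδ.le_one j
  refine ⟨⟨?_, hD.bdd hC.toFixed hB hδ.le_one hlt2 hbd2, ?_⟩, ?_⟩
  · change b.reg 6 ≤ M; omega
  · exact hsum.trans_le (by omega)
  rw [hsum]
  set b₁ := b.setReg 6 (b.reg 6 + δ j) with hb₁
  have hC₁ : Ctx m n k best ε b₁ := hC.setReg _ (by decide)
  have hD₁ : Current n δ b₁ := hD
  have r6 : b₁.reg 6 = b.reg 6 + δ j := by simp [hb₁, State.setReg]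
  have r7 : (Ex.var 7).eval b₁ = b.reg 7 := by simp [hb₁, State.setReg, Ex.eval]
  have r2 : b₁.reg 2 = j := by simp [hb₁, State.setReg, hS.vertex]
  have hlt7 : (Ex.var 7).eval b₁ < n := by rw [r7]; exact hS.lt
  have hbd7 : (Ex.var 7).Bdd M b₁ := by
    have := hS.lt; exact r7.trans_le (by omega)
  have hdom : b.reg 6 + δ j ≠ 0 ↔ Dominated m n δ j := by
    constructor
    · intro h0
      by_cases h1 : b.reg 6 = 0
      · exact ⟨j, hj, .inl rfl, by omega⟩
      · obtain ⟨u, hu, hu', hu''⟩ := hS.flag.1 h1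
        exact ⟨u, hu, .inr hu', hu''⟩
    · rintro ⟨u, hu, rfl | hu1, hu2⟩
      · omega
      · have := hS.flag.2 ⟨u, hu, hu1, hu2⟩; omega
  refine ⟨?_, fun h0 => ?_, fun h0 => ?_⟩
  · change b₁.reg 6 ≤ M; omega
  · refine ⟨r2, hC₁.setReg _ (by decide), δ, hD₁, hδ.step_dominated (hdom.1 ?_)⟩
    rw [← r6]; exact h0
  · have hnd : ¬ Dominated m n δ j := fun h => hdom.2 h (by rw [← r6]; exact h0)
    refine ⟨hC₁.bdd_setAddr hB hlt7 hbd7, (by change 1 ≤ M; omega), r2, ?_, _, ?_,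
      hδ.step_add hnd hS.lt hS.nbr (le_price hj hS.self hS.cheap)⟩
    · rw [hC₁.eval_setAddr]
      exact (hC₁.setMem hlt7 _).setReg _ (by decide)
    · intro u hu
      change Function.update b₁.mem _ _ _ = _
      rw [hC₁.eval_setAddr, r7]
      by_cases hug : u = b.reg 7
      · subst hug; simp [Ex.eval]
      · rw [Function.update_of_ne (by omega), Function.update_of_ne hug]; exact hD₁ u hu

theorem sum_scaledCost_lt (hB : Bounds m n M) (hδ : ∀ u, δ u ≤ 1) {j : ℕ} (hj : j ≤ n) :
    ∑ u ∈ range j, scaledCost m n u * δ u < M :=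
  calc _ ≤ ∑ u ∈ range n, scaledCost m n u * δ u :=
        sum_le_sum_of_subset (range_subset_range.2 hj)
    _ ≤ ∑ u ∈ range n, scaledCost m n u :=
        sum_le_sum fun u _ => by simpa using Nat.mul_le_mul_left (scaledCost m n u) (hδ u)
    _ < M := hB.cost

theorem wp_costLoop (hB : Bounds m n M) (hN : 2 * n + 1 ≤ N) (hδ : ∀ u, δ u ≤ 1) {a : State}
    (hC : Ctx m n k best ε a) (hD : Current n δ a) :
    Cmd.costLoop.wp M N (fun b => Ctx m n k best ε b ∧ Current n δ b ∧
      b.reg 8 = ∑ u ∈ range n, scaledCost m n u * δ u) a := by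
  refine ⟨Nat.zero_le _, ?_⟩
  replace hC : Ctx m n k best ε (a.setReg 8 ((Ex.lit 0).eval a)) := hC.setReg _ (by decide)
  refine Cmd.wp_rep (fun j b => Ctx m n k best ε b ∧ Current n δ b ∧
    b.reg 8 = ∑ u ∈ range j, scaledCost m n u * δ u)
    (hC.bdd_num hB) hC.num (by omega) ⟨hC.setReg 0 (by decide), hD, ?_⟩ ?_
  · simp [State.setReg, Ex.eval]
  rintro j hj b ⟨hC, hD, h8⟩ hi
  have he : (Ex.var 3).eval b = j := hi
  have hlt : (Ex.var 3).eval b < n := by omega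
  have hM := hB.addr
  have hbd : (Ex.var 3).Bdd M b := by change b.reg 3 ≤ M; omega
  have hmul : (Ex.mul (.get (.costAddr (.var 3))) (.get (.setAddr (.var 3)))).eval b =
      scaledCost m n j * δ j := by
    rw [← he]; exact congrArg₂ (· * ·) (hC.eval_cost hlt) (hD.eval hC.toFixed hlt)
  have hsum : (Ex.add (.var 8)
      (.mul (.get (.costAddr (.var 3))) (.get (.setAddr (.var 3))))).eval b =
      ∑ u ∈ range (j + 1), scaledCost m n u * δ u := by
    rw [sum_range_succ, ← h8, ← hmul]; rfl
  have hle := sum_scaledCost_lt hB hδ (j := j + 1) hj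
  have hle' := hle
  rw [sum_range_succ] at hle'
  refine ⟨⟨?_, ⟨hC.bdd_cost hB hlt hbd, hD.bdd hC.toFixed hB hδ hlt hbd, ?_⟩, ?_⟩, ?_, ?_, hD, ?_⟩
  · change b.reg 8 ≤ M; omega
  · exact hmul.trans_le (by omega)
  · exact hsum.trans_le hle.le
  · simpa [State.setReg] using hi
  · exact (hC.setReg _ (by decide)).setReg _ (by decide)
  · rw [hsum]; simp [State.setReg]

/-- `ε` is a dominating set of scaled cost `best`, at least as good as the bounds for the first `j`
thresholds. -/
structure BestOf (m : ℕ → ℕ) (n j best : ℕ) (ε : ℕ → ℕ) : Prop where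
  le_one : ∀ u, ε u ≤ 1
  dom : ∀ w < n, Dominated m n ε w
  cost : ∑ u ∈ range n, scaledCost m n u * ε u = best
  le : ∀ i < j, best ≤ roundCost m n i

theorem wp_compareStep (hB : Bounds m n M) (hN : 2 * n + 1 ≤ N) (hk : k < 2 * n + 1)
    (hbest : best < M) (hε : k ≠ 0 → BestOf m n k best ε) (hδ : Completed m n k n δ) {a : State}
    (hC : Ctx m n k best ε a) (hD : Current n δ a)
    (h8 : a.reg 8 = ∑ u ∈ range n, scaledCost m n u * δ u) :
    Cmd.compareStep.wp M N (fun b => ∃ best' ε', best' < M ∧ Ctx m n k best' ε' b ∧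
      BestOf m n (k + 1) best' ε') a := by
  have hM := hB.addr
  have hthr := hC.thr
  have hbst := hC.bst
  have h8M : a.reg 8 < M := h8.trans_lt (sum_scaledCost_lt hB hδ.le_one le_rfl)
  -- The second summand is `1` exactly in the round `k = 0`. There is no earlier set to compare with
  -- at that point, and the current one must be kept whatever `best` is.
  have htest : (Ex.add (.sub (.var 9) (.var 8)) (.sub (.lit 1) (.var 5))).eval a =
      (best - a.reg 8) + (1 - k) := by rw [← hbst, ← hthr]; rfl
  have hround : a.reg 8 ≤ roundCost m n k := h8.trans_le hδ.cost
  have h9M : a.reg 9 - a.reg 8 ≤ M := by omega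
  -- The strict bound `best < M` leaves room for the additional `1` of the test.
  have hsubM : a.reg 9 - a.reg 8 + (1 - a.reg 5) ≤ M := by omega
  refine ⟨⟨⟨?_, h8M.le, h9M⟩, ⟨?_, ?_, ?_⟩, hsubM⟩, fun h => ?_, fun h => ?_⟩
  · change a.reg 9 ≤ M; omega
  · change 1 ≤ M; omega
  · change a.reg 5 ≤ M; omega
  · change 1 - a.reg 5 ≤ M; omega
  · rw [htest] at h
    refine ⟨h8M.le, ?_⟩
    set a₁ := a.setReg 9 ((Ex.var 8).eval a) with ha₁
    have hC₁ : Ctx m n k (a.reg 8) ε a₁ :=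
      { hC.toFixed.setReg (by decide) (by decide) (by decide) _ with
        costs := hC.costs
        thr := by simp [ha₁, State.setReg, hthr]
        bst := by simp [ha₁, State.setReg, Ex.eval]
        saved := hC.saved }
    -- While the set is being copied, the saved array agrees with `δ` before position `j` and with
    -- the old `ε` from there on.
    refine Cmd.wp_mono _ ?_ (Cmd.wp_rep (fun j b => Current n δ b ∧
      Ctx m n k (a.reg 8) (fun u => if u < j then δ u else ε u) b)
      (hC₁.bdd_num hB) hC₁.num (by omega) ⟨hD, ?_⟩ ?_)
    · rintro b ⟨hD, hC⟩
      refine ⟨a.reg 8, δ, h8M, { hC with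
        saved := fun u hu => by rw [hC.saved u hu, if_pos hu] }, hδ.le_one, hδ.dom, h8.symm, ?_⟩
      intro i hi
      rcases Nat.lt_succ_iff_lt_or_eq.1 hi with hi | rfl
      · have := (hε (by omega)).le i hi
        omega
      · exact hround
    · simpa using hC₁.setReg 0 (by decide)
    · rintro j hj b ⟨hD, hC⟩ hi
      have he : (Ex.var 3).eval b = j := hi
      have hlt : (Ex.var 3).eval b < n := by omega
      have hbd : (Ex.var 3).Bdd M b := by change b.reg 3 ≤ M; omega
      refine ⟨hC.bdd_bestAddr hB hlt hbd, hD.bdd hC.toFixed hB hδ.le_one hlt hbd, hi, ?_, ?_⟩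
      · intro u hu
        change Function.update b.mem _ _ _ = _
        rw [hC.eval_bestAddr, Function.update_of_ne (by omega)]
        exact hD u hu
      · rw [hC.eval_bestAddr, hD.eval hC.toFixed hlt, he]
        refine Ctx.setReg ?_ _ (by decide)
        exact
          { hC.toFixed.setMem (by omega) _ with
            costs := fun v hv => (Function.update_of_ne (by omega) _ _).trans (hC.costs v hv)
            thr := hC.thr
            bst := hC.bst
            saved := fun u hu => by
              change Function.update b.mem _ _ _ = _
              by_cases huj : u = j
              · subst huj; simp
              · rw [Function.update_of_ne (by omega), hC.saved u hu]
                simp only [show (u < j + 1) = (u < j) from propext (by omega)] }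
  · rw [htest] at h
    have hb := hε (by omega)
    refine ⟨best, ε, hbest, hC, hb.le_one, hb.dom, hb.cost, fun i hi => ?_⟩
    rcases Nat.lt_succ_iff_lt_or_eq.1 hi with hi | rfl
    · exact hb.le i hi
    · omega

theorem wp_thresholdLoop (hB : Bounds m n M) (hN : 2 * n + 1 ≤ N) {a : State}
    (hF : Fixed m n a) (hc : ∀ v < n, a.mem (freeCell n + v) = scaledCost m n v)
    (h9 : a.reg 9 = 0) :
    Cmd.thresholdLoop.wp M N (fun b => ∃ best ε, Ctx m n (2 * n + 1) best ε b ∧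
      BestOf m n (2 * n + 1) best ε) a := by
  have hM := hB.addr
  have he : (Ex.add (.mul (.lit 2) (.var 0)) (.lit 1)).eval a = 2 * n + 1 := by
    rw [← hF.num]; rfl
  refine Cmd.wp_mono _ ?_ (Cmd.wp_rep (fun j b => ∃ best ε, best < M ∧ Ctx m n j best ε b ∧
    (j ≠ 0 → BestOf m n j best ε)) ⟨⟨?_, hF.bdd_num hB, ?_⟩, ?_, ?_⟩ he hN ?_ ?_)
  · rintro b ⟨best, ε, _, hC, hε⟩
    exact ⟨best, ε, hC, hε (by omega)⟩
  · change 2 ≤ M; omega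
  · change 2 * a.reg 0 ≤ M; rw [hF.num]; omega
  · change 1 ≤ M; omega
  · exact he.trans_le (by omega)
  -- Before the first round the saved array is whatever stands in the memory; nothing is claimed
  -- about it.
  · refine ⟨0, fun u => a.mem (freeCell n + 2 * n + u), by omega, ?_, fun h => absurd rfl h⟩
    exact
      { hF.setReg (by decide) (by decide) (by decide) _ with
        costs := hc
        thr := by simp [State.setReg]
        bst := by simp [State.setReg, h9]
        saved := fun u _ => rfl }
  rintro j hj b ⟨best, ε, hbest, hC, hε⟩ -
  refine Cmd.wp_seq (wp_heavyLoop hB hN hj hC) ?_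
  rintro b ⟨hC, hD⟩
  refine Cmd.wp_seq (wp_completeLoop hB hN hC hD) ?_
  rintro b ⟨hC, δ, hD, hδ⟩
  refine Cmd.wp_seq (wp_costLoop hB hN hδ.le_one hC hD) ?_
  rintro b ⟨hC, hD, h8⟩
  refine Cmd.wp_mono _ ?_ (wp_compareStep hB hN hj hbest hε hδ hC hD h8)
  rintro b ⟨best', ε', hbest', hC, hε'⟩
  exact ⟨hC.thr, best', ε', hbest',
    { hC.toFixed.setReg (by decide) (by decide) (by decide) _ with
      costs := hC.costs
      thr := by simp [State.setReg]
      bst := by simp [State.setReg, hC.bst]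
      saved := hC.saved }, fun _ => hε'⟩

/-- The output overwrites the first cells of the input, so `Fixed` is lost. The invariant keeps only
the two address variables and the saved array, which lies beyond the cells being written. -/
theorem wp_outputLoop (hB : Bounds m n M) (hN : 2 * n + 1 ≤ N) {a : State}
    (hF : Fixed m n a) (hε : ∀ u, ε u ≤ 1) (hs : ∀ u < n, a.mem (freeCell n + 2 * n + u) = ε u) :
    Cmd.outputLoop.wp M N (fun b => ∀ u < n, b.mem u = ε u) a := by
  have hM := hB.addr
  refine Cmd.wp_mono _ (fun b hb => hb.2.2.2) (Cmd.wp_rep (fun j b => b.reg 0 = n ∧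
    b.reg 1 = freeCell n ∧ (∀ u < n, b.mem (freeCell n + 2 * n + u) = ε u) ∧
    ∀ u < j, b.mem u = ε u) (hF.bdd_num hB) hF.num (by omega) ?_ ?_)
  · exact ⟨hF.num, hF.free, hs, by simp⟩
  rintro j hj b ⟨h0, h1, hs, hu⟩ hi
  have haddr : (Ex.bestAddr (.var 3)).eval b = freeCell n + 2 * n + j := by
    rw [← h0, ← hi]; simp [Ex.bestAddr, Ex.add, Ex.mul, Ex.eval, ArithOp.eval, h0, h1]
  have hget : (Ex.get (.bestAddr (.var 3))).eval b = ε j := by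
    change b.mem (Ex.eval b _) = _
    rw [haddr, hs j hj]
  have hf : freeCell n + 2 * n + j ≤ M := by unfold freeCell; omega
  have hεj := hε j
  refine ⟨?_, ⟨⟨⟨?_, ⟨?_, ?_, ?_⟩, ?_⟩, ?_, haddr.trans_le hf⟩, hget.trans_le (by omega)⟩,
    hi, h0, h1, ?_, ?_⟩
  · change b.reg 3 ≤ M; omega
  · change b.reg 1 ≤ M; omega
  · change 2 ≤ M; omega
  · change b.reg 0 ≤ M; omega
  · change 2 * b.reg 0 ≤ M; omega
  · change b.reg 1 + 2 * b.reg 0 ≤ M; omega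
  · change b.reg 3 ≤ M; omega
  · intro u hu'
    change Function.update b.mem (b.reg 3) _ _ = _
    rw [Function.update_of_ne (by unfold freeCell; omega)]
    exact hs u hu'
  · intro u hu'
    change Function.update b.mem (b.reg 3) _ _ = _
    rw [hget, hi]
    by_cases huj : u = j
    · subst huj; simp
    · rw [Function.update_of_ne huj]; exact hu u (by omega)

theorem wp_rounding (hB : Bounds m n M) (hN : 2 * n + 1 ≤ N) (hm : m 0 = n) :
    Cmd.rounding.wp M N (fun b => ∃ best ε, BestOf m n (2 * n + 1) best ε ∧
      ∀ u < n, b.mem u = ε u) ⟨fun _ => 0, m⟩ := by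
  have hM := hB.addr
  refine Cmd.wp_seq (P := fun b => Fixed m n b ∧ b.reg 4 = 1 ∧ b.reg 9 = 0) ?_ ?_
  · simp only [Cmd.initStep, Cmd.wp, Ex.add, Ex.mul, Ex.Bdd, Ex.eval, ArithOp.eval, State.setReg,
      hm]
    simp only [ne_eq, OfNat.ofNat_ne_zero, OfNat.ofNat_ne_one, not_false_eq_true,
      OfNat.zero_ne_ofNat, Function.update_of_ne, Function.update_self, Nat.reduceEqDiff]
    refine ⟨⟨Nat.zero_le _, by omega⟩, ⟨by omega, ⟨by omega, by omega, by omega⟩, by omega⟩,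
      ⟨by omega, ⟨by omega, by omega, by omega⟩, by omega⟩, by omega, ⟨?_, ?_, ?_, ?_⟩, ?_, ?_⟩
    · simp
    · simp [freeCell]; ring
    · simp
    · simp
    · trivial
    · trivial
  rintro b ⟨hF, h4, h9⟩
  refine Cmd.wp_seq (wp_prodLoop hB hN hF h4) ?_
  rintro b ⟨hF, h4, h9'⟩
  refine Cmd.wp_seq (wp_scaleLoop hB hN hF h4) ?_
  rintro b ⟨hF, hc, h9''⟩
  refine Cmd.wp_seq (wp_thresholdLoop hB hN hF hc (by rw [h9'', h9', h9])) ?_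
  rintro b ⟨best, ε, hC, hε⟩
  exact Cmd.wp_mono _ (fun b hb => ⟨best, ε, hε, hb⟩)
    (wp_outputLoop hB hN hC.toFixed hε.le_one hC.saved)

end Verify

/-! ## Orientations of small outdegree, and rounding -/

/-- The edges of `G` can be oriented such that every outdegree is at most `d`. -/
def HasOrientation {V : Type*} [Fintype V] (G : SimpleGraph V) (d : ℕ) : Prop :=
  ∃ R : V → V → Prop, (∀ u v, G.Adj u v → R u v ∨ R v u) ∧ ∀ u, #{v | R u v} ≤ d

/-- Needed when the bound for a family exceeds the number of vertices, since the program tries only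
finitely many thresholds. -/
theorem hasOrientation_card {V : Type*} [Fintype V] (G : SimpleGraph V) :
    HasOrientation G (Fintype.card V) :=
  by
  refine ⟨fun _ _ => True, by simp, fun u => ?_⟩
  exact card_le_univ _

/-- The vertices that are incident to an edge of `A`. -/
def touched {V : Type*} [Fintype V] (A : Finset (Sym2 V)) : Finset V := {v | ∃ e ∈ A, v ∈ e}

theorem mem_touched {V : Type*} [Fintype V] {A : Finset (Sym2 V)} {v : V} :
    v ∈ touched A ↔ ∃ e ∈ A, v ∈ e := by simp [touched]

/-- By Hall's theorem, a graph all of whose subgraphs are sparse has an orientation of small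
outdegree. -/
theorem hasOrientation_of_sparse {V : Type*} [Fintype V] (G : SimpleGraph V) (d : ℕ)
    (h : ∀ A : Finset (Sym2 V), A ⊆ G.edgeFinset → #A ≤ d * #(touched A)) :
    HasOrientation G d := by
  -- Every vertex offers `d` slots, and an edge may take any slot of either end. The slots available
  -- to a set of edges are those of the vertices it touches, so sparsity is Hall's condition. An
  -- edge is then directed away from the end whose slot it takes.
  let slots : G.edgeSet → Finset (V × Fin d) := fun e =>
    ({v | v ∈ e.1} : Finset V) ×ˢ univ
  obtain ⟨f, hf, hf'⟩ := (Finset.all_card_le_biUnion_card_iff_exists_injective slots).1 (by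
    intro s
    have h1 := h (s.map (Function.Embedding.subtype _)) (by
      intro e he
      obtain ⟨x, hx, rfl⟩ := mem_map.1 he
      exact SimpleGraph.mem_edgeFinset.2 x.2)
    rw [card_map] at h1
    refine h1.trans ?_
    have : touched (s.map (Function.Embedding.subtype _)) ×ˢ (univ : Finset (Fin d)) ⊆
        s.biUnion slots := by
      rintro ⟨v, i⟩ hv
      obtain ⟨e, he, hve⟩ := mem_touched.1 (mem_product.1 hv).1
      obtain ⟨x, hx, rfl⟩ := mem_map.1 he
      exact mem_biUnion.2 ⟨x, hx, by simpa [slots] using hve⟩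
    have := card_le_card this
    rwa [card_product, card_fin, mul_comm] at this)
  obtain ⟨R, hR⟩ : ∃ R : V → V → Prop, ∀ u v, R u v ↔
      ∃ h : G.Adj u v, (f ⟨s(u, v), h⟩).1 = u := ⟨_, fun _ _ => Iff.rfl⟩
  refine ⟨R, fun u v huv => ?_, fun u => ?_⟩
  · have h1 := hf' ⟨s(u, v), huv⟩
    simp only [slots, mem_product, mem_filter, mem_univ, true_and, and_true, Sym2.mem_iff] at h1
    rcases h1 with h1 | h1
    · exact .inl ((hR u v).2 ⟨huv, h1⟩)
    · refine .inr ((hR v u).2 ⟨huv.symm, ?_⟩)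
      have : (⟨s(v, u), huv.symm⟩ : G.edgeSet) = ⟨s(u, v), huv⟩ := Subtype.ext Sym2.eq_swap
      rw [this]
      exact h1
  -- Edges leaving `u` occupy different slots of `u`, so the slot index separates the
  -- out-neighbours. The value `none` is a default that does not occur on them.
  · let g : V → Option (Fin d) := fun v =>
      if h : G.Adj u v then some (f ⟨s(u, v), h⟩).2 else none
    have hg : ∀ v (h : G.Adj u v), g v = some (f ⟨s(u, v), h⟩).2 := fun v h => dif_pos h
    refine (card_le_card_of_injOn (t := univ.map Function.Embedding.some) g ?_ ?_).trans_eq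
      (by simp)
    · intro v hv
      obtain ⟨h, _⟩ := (hR u v).1 (mem_filter.1 hv).2
      rw [hg v h]
      simp
    · intro v hv w hw hvw
      obtain ⟨h, h1⟩ := (hR u v).1 (mem_filter.1 hv).2
      obtain ⟨h', h2⟩ := (hR u w).1 (mem_filter.1 hw).2
      rw [hg v h, hg w h'] at hvw
      have := hf (Prod.ext (h1.trans h2.symm) (Option.some.inj hvw))
      have := congrArg Subtype.val this
      exact Sym2.congr_right.1 this

/-! ### The rounding argument and the integrality gap -/

theorem mem_closedNbhd {V : Type*} [Fintype V] {G : SimpleGraph V} {u v : V} :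
    u ∈ closedNbhd G v ↔ u = v ∨ G.Adj v u := by simp [closedNbhd]

/-- The analysis of the rounding: the vertices of value at least `1 / (2 * d + 1)`, together with
the prices `p` of the vertices that they do not dominate. -/
theorem rounding_bound {V : Type*} [Fintype V] {G : SimpleGraph V} {d : ℕ}
    (hG : HasOrientation G d) {c x p : V → ℝ} (hc : ∀ v, 0 ≤ c v) (hx : IsFractional G x)
    (hp : ∀ v, ∀ u ∈ closedNbhd G v, p v ≤ c u) (hp0 : ∀ v, 0 ≤ p v) :
    ∑ u, (if 1 ≤ x u * (2 * d + 1) then c u else 0) +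
      ∑ v, (if ∃ u ∈ closedNbhd G v, 1 ≤ x u * (2 * d + 1) then 0 else p v) ≤
      (2 * d + 1) * ∑ v, c v * x v := by
  obtain ⟨R, hR, hdeg⟩ := hG
  set κ : ℝ := 2 * d + 1 with hκ
  have hκ0 : 0 < κ := by positivity
  set H : Finset V := {u | 1 ≤ x u * κ} with hH
  set U : Finset V := {v | ¬ ∃ u ∈ closedNbhd G v, 1 ≤ x u * κ} with hU
  have e1 : ∑ u, (if 1 ≤ x u * κ then c u else 0) = ∑ u ∈ H, c u := by
    rw [hH, sum_filter]
  have e2 : ∑ v, (if ∃ u ∈ closedNbhd G v, 1 ≤ x u * κ then 0 else p v) = ∑ v ∈ U, p v := by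
    rw [hU, sum_filter]
    refine sum_congr rfl fun v _ => ?_
    by_cases h : ∃ u ∈ closedNbhd G v, 1 ≤ x u * κ <;> simp only [h, if_true, if_false, not_true,
      not_false_eq_true]
  rw [e1, e2, ← sum_add_sum_compl H fun v => c v * x v, mul_add]
  refine add_le_add ?_ ?_
  · rw [mul_sum]
    refine sum_le_sum fun u hu => ?_
    have hu' : 1 ≤ x u * κ := (mem_filter.1 hu).2
    nlinarith [hc u, mul_le_mul_of_nonneg_left hu' (hc u)]
  -- for an undominated vertex, the in-neighbours and the vertex itself have a large total value
  have key : ∀ v ∈ U, (d + 1 : ℝ) ≤ κ * ∑ u ∈ Hᶜ, if v = u ∨ R u v then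
      (if u ∈ closedNbhd G v then x u else 0) else 0 := by
    intro v hv
    have hv' : ∀ u ∈ closedNbhd G v, x u * κ < 1 := by
      intro u hu
      by_contra! h
      exact (mem_filter.1 hv).2 ⟨u, hu, h⟩
    have hsub : closedNbhd G v ⊆ Hᶜ := fun u hu => by
      rw [mem_compl, hH, mem_filter]
      exact fun h => absurd h.2 (not_le.2 (hv' u hu))
    have h1 : ∑ u ∈ Hᶜ, (if v = u ∨ R u v then
        (if u ∈ closedNbhd G v then x u else 0) else 0) =
        ∑ u ∈ closedNbhd G v, if v = u ∨ R u v then x u else 0 := by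
      rw [← sum_subset hsub (f := fun u => if v = u ∨ R u v then
        (if u ∈ closedNbhd G v then x u else 0) else 0)]
      · refine sum_congr rfl fun u hu => ?_
        rw [if_pos hu]
      · intro u _ hu
        rw [if_neg hu, ite_self]
    rw [h1]
    -- A member of the closed neighbourhood that is neither `v` nor an in-neighbour is an
    -- out-neighbour.
    have h2 : ∑ u ∈ closedNbhd G v, x u ≤ (∑ u ∈ closedNbhd G v, if v = u ∨ R u v then x u else 0) +
        ∑ u ∈ ({u | R v u} : Finset V), if u ∈ closedNbhd G v then x u else 0 := by
      rw [sum_filter, ← sum_subset (subset_univ (closedNbhd G v)), ← sum_add_distrib]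
      · refine sum_le_sum fun u hu => ?_
        have hxu := hx.2 u
        rw [if_pos hu]
        by_cases h : v = u ∨ R u v
        · rw [if_pos h]; split_ifs <;> linarith
        · rw [if_neg h]
          rw [not_or] at h
          have : R v u := by
            rcases mem_closedNbhd.1 hu with h' | h'
            · exact absurd h'.symm h.1
            · exact (hR v u h').resolve_right h.2
          rw [if_pos this, zero_add]
      · intro u _ hu
        rw [if_neg hu, ite_self]
    -- There are at most `d` out-neighbours, and `κ` times the value of each that counts is below
    -- `1`. Of the total `κ = 2 * d + 1`, at least `d + 1` is left for `v` and its in-neighbours.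
    have h3 : κ * ∑ u ∈ ({u | R v u} : Finset V), (if u ∈ closedNbhd G v then x u else 0) ≤ d := by
      rw [mul_sum]
      refine (sum_le_card_nsmul _ _ 1 fun u _ => ?_).trans ?_
      · by_cases hu : u ∈ closedNbhd G v
        · rw [if_pos hu]; linarith [hv' u hu]
        · rw [if_neg hu]; simp
      · rw [nsmul_eq_mul, mul_one]
        exact_mod_cast hdeg v
    have h4 := mul_le_mul_of_nonneg_left ((hx.1 v).trans h2) hκ0.le
    rw [mul_add, mul_one] at h4
    linarith
  have hd1 : (0 : ℝ) < d + 1 := by positivity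
  refine le_of_mul_le_mul_left ?_ hd1
  calc (d + 1 : ℝ) * ∑ v ∈ U, p v = ∑ v ∈ U, p v * (d + 1) := by
        rw [mul_sum]; exact sum_congr rfl fun _ _ => mul_comm _ _
    _ ≤ ∑ v ∈ U, κ * ∑ u ∈ Hᶜ, if v = u ∨ R u v then c u * x u else 0 := by
        refine sum_le_sum fun v hv => ?_
        refine (mul_le_mul_of_nonneg_left (key v hv) (hp0 v)).trans ?_
        rw [mul_left_comm, mul_sum]
        refine mul_le_mul_of_nonneg_left (sum_le_sum fun u _ => ?_) hκ0.le
        by_cases h : v = u ∨ R u v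
        · rw [if_pos h, if_pos h]
          by_cases hu : u ∈ closedNbhd G v
          · rw [if_pos hu]
            exact mul_le_mul_of_nonneg_right (hp v u hu) (hx.2 u)
          · rw [if_neg hu, mul_zero]
            exact mul_nonneg (hc u) (hx.2 u)
        · rw [if_neg h, if_neg h, mul_zero]
    _ = κ * ∑ u ∈ Hᶜ, ∑ v ∈ U, if v = u ∨ R u v then c u * x u else 0 := by
        rw [← mul_sum, sum_comm]
    _ ≤ κ * ∑ u ∈ Hᶜ, (d + 1) * (c u * x u) := by
        refine mul_le_mul_of_nonneg_left (sum_le_sum fun u _ => ?_) hκ0.le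
        rw [← sum_filter, sum_const, nsmul_eq_mul]
        refine mul_le_mul_of_nonneg_right ?_ (mul_nonneg (hc u) (hx.2 u))
        -- Double counting: `u` is charged only by itself and by its out-neighbours.
        have : #{v ∈ U | v = u ∨ R u v} ≤ d + 1 := by
          calc #{v ∈ U | v = u ∨ R u v} ≤ #(insert u ({v | R u v} : Finset V)) := by
                refine card_le_card fun v hv => ?_
                simpa using (mem_filter.1 hv).2
            _ ≤ _ := (card_insert_le _ _).trans (Nat.add_le_add_right (hdeg u) 1)
        exact_mod_cast this
    _ = (d + 1) * (κ * ∑ u ∈ Hᶜ, c u * x u) := by rw [← mul_sum]; ring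

theorem self_mem_closedNbhd {V : Type*} [Fintype V] {G : SimpleGraph V} (v : V) :
    v ∈ closedNbhd G v := mem_closedNbhd.2 (.inl rfl)

theorem isFractional_one {V : Type*} [Fintype V] (G : SimpleGraph V) :
    IsFractional G fun _ => 1 :=
  ⟨fun v => by
    have := single_le_sum (f := fun _ => (1 : ℝ)) (fun _ _ => zero_le_one)
      (self_mem_closedNbhd (G := G) v)
    exact this, fun _ => zero_le_one⟩

/-- The integrality gap concerns real costs, which the program cannot read. Here the same rounding
is carried out directly, with the one threshold that fits `d` and the prices realised by cheapest
dominating vertices `g v`. -/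
theorem exists_isDominating_cost_le {V : Type*} [Fintype V] {G : SimpleGraph V} {d : ℕ}
    (hG : HasOrientation G d) {c x : V → ℝ} (hc : ∀ v, 0 ≤ c v) (hx : IsFractional G x) :
    ∃ D : Finset V, IsDominating G D ∧ ∑ v ∈ D, c v ≤ (2 * d + 1) * ∑ v, c v * x v := by
  choose g hg hgmin using fun v => exists_min_image (closedNbhd G v) c ⟨v, self_mem_closedNbhd v⟩
  refine ⟨({u | 1 ≤ x u * (2 * d + 1)} : Finset V) ∪
    ({v | ¬ ∃ u ∈ closedNbhd G v, 1 ≤ x u * (2 * d + 1)} : Finset V).image g, ?_, ?_⟩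
  · intro v hv
    by_cases h : ∃ u ∈ closedNbhd G v, 1 ≤ x u * (2 * d + 1)
    · obtain ⟨u, hu, hu'⟩ := h
      have hmem : u ∈ ({u | 1 ≤ x u * (2 * d + 1)} : Finset V) := by simpa using hu'
      rcases mem_closedNbhd.1 hu with rfl | h
      · exact absurd (mem_union_left _ hmem) hv
      · exact ⟨u, mem_union_left _ hmem, h⟩
    · have hmem : g v ∈ ({v | ¬ ∃ u ∈ closedNbhd G v, 1 ≤ x u * (2 * d + 1)} : Finset V).image g :=
        mem_image_of_mem _ (by simpa using h)
      rcases mem_closedNbhd.1 (hg v) with h | h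
      · rw [h] at hmem
        exact absurd (mem_union_right _ hmem) hv
      · exact ⟨_, mem_union_right _ hmem, h⟩
  · refine le_trans ?_ (rounding_bound hG hc hx hgmin fun v => hc _)
    have e1 : ∑ u, (if 1 ≤ x u * (2 * d + 1) then c u else 0) =
        ∑ u ∈ ({u | 1 ≤ x u * (2 * d + 1)} : Finset V), c u := by rw [sum_filter]
    have e2 : ∑ v, (if ∃ u ∈ closedNbhd G v, 1 ≤ x u * (2 * d + 1) then 0 else c (g v)) =
        ∑ v ∈ ({v | ¬ ∃ u ∈ closedNbhd G v, 1 ≤ x u * (2 * d + 1)} : Finset V), c (g v) := by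
      rw [sum_filter]
      refine sum_congr rfl fun v _ => ?_
      by_cases h : ∃ u ∈ closedNbhd G v, 1 ≤ x u * (2 * d + 1) <;>
        simp only [h, if_true, if_false, not_true, not_false_eq_true]
    rw [e1, e2]
    have h1 := sum_union_inter (f := c) (s₁ := ({u | 1 ≤ x u * (2 * d + 1)} : Finset V)) (s₂ :=
      ({v | ¬ ∃ u ∈ closedNbhd G v, 1 ≤ x u * (2 * d + 1)} : Finset V).image g)
    have h2 := sum_nonneg (s := ({u | 1 ≤ x u * (2 * d + 1)} : Finset V) ∩
      ({v | ¬ ∃ u ∈ closedNbhd G v, 1 ≤ x u * (2 * d + 1)} : Finset V).image g) fun v _ => hc v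
    have h3 := sum_image_le_of_nonneg
      (s := ({v | ¬ ∃ u ∈ closedNbhd G v, 1 ≤ x u * (2 * d + 1)} : Finset V)) (g := g)
      (f := c) fun v _ => hc v
    linarith

theorem integralityGapLE_of_hasOrientation {F : GraphFamily} {d : ℕ}
    (h : ∀ n, ∀ G ∈ F n, HasOrientation G d) : IntegralityGapLE F (2 * d + 1) := by
  intro n G hG c hc
  have hd : (0 : ℝ) < 2 * d + 1 := by positivity
  rw [← div_le_iff₀' hd]
  refine le_csInf ⟨∑ v, c v * 1, fun _ => 1, isFractional_one G, rfl⟩ ?_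
  rintro z ⟨x, hx, rfl⟩
  rw [div_le_iff₀' hd]
  obtain ⟨D, hD, hle⟩ := exists_isDominating_cost_le (h n G hG) hc hx
  have hbdd : BddBelow {z | ∃ D : Finset (Fin n), IsDominating G D ∧ z = ∑ v ∈ D, c v} := by
    refine ⟨0, ?_⟩
    rintro z ⟨D', _, rfl⟩
    exact sum_nonneg fun v _ => hc v
  exact (csInf_le hbdd ⟨D, hD, rfl⟩).trans hle

/-! ## Graphs without a given minor are sparse -/

section Mader

variable {V : Type*} (G : SimpleGraph V)

/-- The number of ordered pairs of adjacent vertices in `X`. -/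
def pairCount (X : Finset V) : ℕ := ∑ v ∈ X, #{u ∈ X | G.Adj v u}

/-- The neighbours of `U` in `X \ U`. -/
def nbrsIn (X U : Finset V) : Finset V := {v ∈ X \ U | ∃ u ∈ U, G.Adj u v}

/-- `G` has a model of the complete graph on `t` vertices inside `X`. -/
def HasCliqueModel (t : ℕ) (X : Finset V) : Prop :=
  ∃ B : Fin t → Set V, (∀ i, B i ⊆ X) ∧ (∀ i, (G.induce (B i)).Connected) ∧
    (∀ i j, i ≠ j → Disjoint (B i) (B j)) ∧
    ∀ i j, i ≠ j → ∃ u ∈ B i, ∃ v ∈ B j, G.Adj u v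

variable {G}

theorem HasCliqueModel.mono {t : ℕ} {X Y : Finset V} (h : X ⊆ Y) (hX : HasCliqueModel G t X) :
    HasCliqueModel G t Y := by
  obtain ⟨B, h1, h2⟩ := hX
  exact ⟨B, fun i => (h1 i).trans (by exact_mod_cast h), h2⟩

theorem pairCount_insert {w : V} {Y : Finset V} (hw : w ∉ Y) :
    pairCount G (insert w Y) = pairCount G Y + 2 * #{u ∈ Y | G.Adj w u} := by
  have h1 : ∀ v, #{u ∈ insert w Y | G.Adj v u} =
      (if G.Adj v w then 1 else 0) + #{u ∈ Y | G.Adj v u} := by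
    intro v
    rw [filter_insert]
    split_ifs with h
    · rw [card_insert_of_notMem (by simp [hw]), add_comm]
    · rw [zero_add]
  unfold pairCount
  rw [sum_insert hw, h1, if_neg (G.loopless.irrefl w), zero_add, sum_congr rfl fun v _ => h1 v,
    sum_add_distrib, ← card_filter]
  simp only [G.adj_comm _ w]
  ring

/-- `U` is adjacent to every vertex of its neighbourhood, hence to every branch set in there, and
serves as one more branch set. -/
theorem hasCliqueModel_succ {t : ℕ} {X U : Finset V} (hUX : U ⊆ X)
    (hU : (G.induce (U : Set V)).Connected) (h : HasCliqueModel G t (nbrsIn G X U)) :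
    HasCliqueModel G (t + 1) X := by
  obtain ⟨B, h1, h2, h3, h4⟩ := h
  have hmem : ∀ i, ∀ v ∈ B i, v ∈ X ∧ v ∉ U ∧ ∃ u ∈ U, G.Adj u v := fun i v hv => by
    have := h1 i hv
    simpa [nbrsIn, and_assoc] using this
  have hdisj : ∀ i, Disjoint (U : Set V) (B i) := fun i =>
    Set.disjoint_left.2 fun v hv hv' => (hmem i v hv').2.1 hv
  have hadj : ∀ i, ∃ u ∈ (U : Set V), ∃ v ∈ B i, G.Adj u v := fun i => by
    obtain ⟨v, hv⟩ := (h2 i).nonempty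
    obtain ⟨u, hu, huv⟩ := (hmem i v hv).2.2
    exact ⟨u, hu, v, hv, huv⟩
  refine ⟨Fin.cons (U : Set V) B, ?_, ?_, ?_, ?_⟩
  · refine Fin.cases ?_ ?_
    · exact_mod_cast hUX
    · exact fun i v hv => (hmem i v hv).1
  · exact Fin.cases hU h2
  · refine Fin.cases (Fin.cases (fun h => absurd rfl h) fun j _ => hdisj j) fun i =>
      Fin.cases (fun _ => (hdisj i).symm) fun j hij => h3 i j fun h => hij (h ▸ rfl)
  · refine Fin.cases (Fin.cases (fun h => absurd rfl h) fun j _ => hadj j) fun i =>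
      Fin.cases (fun _ => ?_) fun j hij => h4 i j fun h => hij (h ▸ rfl)
    obtain ⟨u, hu, v, hv, huv⟩ := hadj i
    exact ⟨v, hv, u, hu, huv.symm⟩

/-- `pairCount G (X \ U) + 2 * #(nbrsIn G X U)` counts the ordered adjacent pairs once `U` is
contracted to a vertex. Absorbing `w` loses the edge between `w` and that vertex, and one of two
parallel edges for each common neighbour; all other edges survive. -/
theorem contract_count {X U : Finset V} {w : V} (hw : w ∈ nbrsIn G X U) :
    pairCount G (X \ U) + 2 * #(nbrsIn G X U) ≤
      pairCount G (X \ insert w U) + 2 * #(nbrsIn G X (insert w U)) + 2 +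
        2 * #{u ∈ nbrsIn G X U | G.Adj w u} := by
  obtain ⟨hwX, hwU⟩ : w ∈ X ∧ w ∉ U := mem_sdiff.1 (mem_filter.1 hw).1
  have h1 : X \ U = insert w (X \ insert w U) := by
    ext v
    simp only [mem_sdiff, mem_insert, not_or]
    by_cases h : v = w
    · subst h; simp [hwX, hwU]
    · simp [h]
  have h2 := pairCount_insert (G := G) (w := w) (Y := X \ insert w U) (by simp)
  rw [← h1] at h2
  have h3 : #{u ∈ X \ insert w U | G.Adj w u} ≤
      #{u ∈ nbrsIn G X U | G.Adj w u} +
        #{u ∈ X \ insert w U | G.Adj w u ∧ u ∉ nbrsIn G X U} := by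
    refine (card_le_card fun u hu => ?_).trans (card_union_le _ _)
    obtain ⟨hu, hwu⟩ := mem_filter.1 hu
    by_cases h : u ∈ nbrsIn G X U
    · exact mem_union_left _ (mem_filter.2 ⟨h, hwu⟩)
    · exact mem_union_right _ (mem_filter.2 ⟨hu, hwu, h⟩)
  have h4 : #(nbrsIn G X U) + #{u ∈ X \ insert w U | G.Adj w u ∧ u ∉ nbrsIn G X U} ≤
      #(nbrsIn G X (insert w U)) + 1 := by
    rw [← card_union_of_disjoint]
    · refine (card_le_card (t := insert w (nbrsIn G X (insert w U))) ?_).trans (card_insert_le _ _)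
      intro v hv
      simp only [nbrsIn, mem_union, mem_filter, mem_sdiff, mem_insert, not_or] at hv ⊢
      by_cases hvw : v = w
      · exact .inl hvw
      · rcases hv with ⟨⟨h1, h2⟩, u, hu, huv⟩ | ⟨h1, h2, _⟩
        · exact .inr ⟨⟨h1, hvw, h2⟩, u, .inr hu, huv⟩
        · exact .inr ⟨h1, w, .inl rfl, h2⟩
    · exact disjoint_left.2 fun v hv hv' => (mem_filter.1 hv').2.2 hv
  omega

/-- Contract a connected set `U` as far as the density of the contracted graph permits. By
maximality each further contraction destroys many edges, so each neighbour of `U` has many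
neighbours among the neighbours of `U`. That neighbourhood has minimum degree at least `2 ^ t`, and
induction on `t` applies to it, with `U` as the additional branch set. -/
theorem hasCliqueModel_of_dense (t : ℕ) : ∀ X : Finset V, X.Nonempty →
    2 ^ t * #X ≤ pairCount G X → HasCliqueModel G t X := by
  induction t with
  | zero => exact fun X _ _ => ⟨Fin.elim0, fun i => i.elim0, fun i => i.elim0, fun i => i.elim0,
      fun i => i.elim0⟩
  | succ t ih =>
    intro X
    induction X using Finset.strongInduction with
    | H X ihX =>
      intro hX hdense
      -- The `+ 1` is the vertex to which `U` is contracted.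
      let good : Finset (Finset V) := X.powerset.filter fun U =>
        (G.induce (U : Set V)).Connected ∧
          2 ^ (t + 1) * (#(X \ U) + 1) ≤ pairCount G (X \ U) + 2 * #(nbrsIn G X U)
      have hgood : good.Nonempty := by
        obtain ⟨v, hv⟩ := hX
        refine ⟨{v}, mem_filter.2 ⟨by simpa using hv, ?_, ?_⟩⟩
        · rw [coe_singleton]
          exact SimpleGraph.Connected.mk (fun a b => by
            rw [Subtype.ext (a.2.trans b.2.symm)])
        · have h1 : insert v (X \ {v}) = X := by
            rw [← erase_eq, insert_erase hv]
          have h2 := pairCount_insert (G := G) (w := v) (Y := X \ {v}) (by simp)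
          have h3 : nbrsIn G X {v} = {u ∈ X \ {v} | G.Adj v u} := by
            ext u; simp [nbrsIn]
          have h4 := card_insert_of_notMem (s := X \ {v}) (a := v) (by simp)
          rw [h1] at h2 h4
          rw [h3, ← h2, ← h4]
          exact hdense
      obtain ⟨U, hU, hmax⟩ := good.exists_max_image card hgood
      obtain ⟨hUX, hconn, hcount⟩ := mem_filter.1 hU
      rw [mem_powerset] at hUX
      obtain ⟨⟨u₀, hu₀⟩⟩ := hconn.nonempty
      have hu₀' : u₀ ∈ U := hu₀
      by_cases hN : (nbrsIn G X U).Nonempty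
      · refine hasCliqueModel_succ hUX hconn (ih _ hN ?_)
        unfold pairCount
        rw [mul_comm, ← smul_eq_mul]
        refine card_nsmul_le_sum _ _ _ fun w hw => ?_
        obtain ⟨⟨hwX, hwU⟩, u, hu, huw⟩ : (w ∈ X ∧ w ∉ U) ∧ ∃ u ∈ U, G.Adj u w := by
          simpa [nbrsIn] using hw
        have hnot : insert w U ∉ good := fun h => by
          have := hmax _ h
          rw [card_insert_of_notMem hwU] at this
          omega
        have hconn' : (G.induce ((insert w U : Finset V) : Set V)).Connected := by
          have := SimpleGraph.connected_induce_union (G := G) (s := (U : Set V)) (t := {w})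
            (v := u) (w := w) hconn.preconnected (by
              intro a b
              rw [Subtype.ext (a.2.trans b.2.symm)]) hu rfl huw
          rwa [coe_insert, Set.insert_eq, Set.union_comm]
        have hlt : pairCount G (X \ insert w U) + 2 * #(nbrsIn G X (insert w U)) <
            2 ^ (t + 1) * (#(X \ insert w U) + 1) := by
          by_contra! h
          exact hnot (mem_filter.2 ⟨mem_powerset.2 (insert_subset hwX hUX), hconn', h⟩)
        have hcard : #(X \ U) = #(X \ insert w U) + 1 := by
          rw [← card_insert_of_notMem (s := X \ insert w U) (a := w) (by simp)]
          congr 1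
          ext v
          simp only [mem_sdiff, mem_insert, not_or]
          by_cases h : v = w
          · subst h; simp [hwX, hwU]
          · simp [h]
        -- Absorbing `w` lowers the required number of pairs by `2 * 2 ^ t`, yet the actual number
        -- falls below the requirement. So the loss, at most `2` plus twice the number of common
        -- neighbours, exceeds `2 * 2 ^ t`, and there are at least `2 ^ t` common neighbours.
        have := contract_count hw
        rw [hcard] at hcount
        have e : 2 ^ (t + 1) * (#(X \ insert w U) + 1 + 1) =
          2 ^ (t + 1) * (#(X \ insert w U) + 1) + 2 * 2 ^ t := by ring
        omega
      -- Without neighbours in `X`, the set `U` can be discarded: the rest is smaller and still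
      -- dense. It is nonempty because the required number of pairs is positive.
      · rw [not_nonempty_iff_eq_empty] at hN
        rw [hN, card_empty, mul_zero, add_zero] at hcount
        have hlt : X \ U ⊂ X := sdiff_ssubset hUX ⟨u₀, hu₀'⟩
        refine (ihX _ hlt ?_ ?_).mono hlt.subset
        · rw [nonempty_iff_ne_empty]
          intro h
          rw [h] at hcount
          have : 0 < 2 ^ (t + 1) := by positivity
          simp [pairCount] at hcount
        · exact le_trans (Nat.mul_le_mul_left _ (Nat.le_succ _)) hcount

end Mader

/-- The density theorem is applied to the subgraph with edge set `A` on the vertices it touches.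
There every edge gives two ordered pairs. -/
theorem card_le_of_not_hasCliqueModel {V : Type*} [Fintype V] {G : SimpleGraph V} {t : ℕ}
    (h : ¬ HasCliqueModel G t univ) (A : Finset (Sym2 V)) (hA : A ⊆ G.edgeFinset) :
    #A ≤ 2 ^ t * #(touched A) := by
  by_contra! hlt
  obtain ⟨H, hH⟩ : ∃ H, H = SimpleGraph.fromEdgeSet (A : Set (Sym2 V)) := ⟨_, rfl⟩
  have hHadj : ∀ u v, H.Adj u v ↔ s(u, v) ∈ A ∧ u ≠ v := fun u v => by
    rw [hH]; exact SimpleGraph.fromEdgeSet_adj _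
  have hHG : H ≤ G := fun u v huv => by
    exact SimpleGraph.mem_edgeFinset.1 (hA ((hHadj u v).1 huv).1)
  have hedge : H.edgeFinset = A := by
    ext e
    rw [SimpleGraph.mem_edgeFinset, hH, SimpleGraph.edgeSet_fromEdgeSet]
    simp only [Set.mem_sdiff, mem_coe, and_iff_left_iff_imp]
    exact fun he => G.not_isDiag_of_mem_edgeSet (SimpleGraph.mem_edgeFinset.1 (hA he))
  have hcount : pairCount H (touched A) = 2 * #A := by
    have h0 := (SimpleGraph.sum_degrees_eq_twice_card_edges H).trans
      (congrArg (fun s => 2 * #s) hedge)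
    rw [← h0]
    unfold pairCount
    have hadj : ∀ u v, H.Adj u v → v ∈ touched A := fun u v huv =>
      mem_touched.2 ⟨_, ((hHadj u v).1 huv).1, Sym2.mem_mk_right _ _⟩
    rw [sum_subset (subset_univ _)]
    · refine sum_congr rfl fun v _ => ?_
      rw [← SimpleGraph.card_neighborFinset_eq_degree]
      congr 1
      ext u
      simp only [mem_filter, SimpleGraph.mem_neighborFinset]
      exact ⟨fun h => h.2, fun h => ⟨hadj v u h, h⟩⟩
    · intro v _ hv
      rw [card_eq_zero, filter_eq_empty_iff]
      exact fun u _ huv => hv (hadj u v huv.symm)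
  have hne : (touched A).Nonempty := by
    obtain ⟨e, he⟩ : A.Nonempty := card_pos.1 (by omega)
    induction e with
    | h u v => exact ⟨u, mem_touched.2 ⟨_, he, Sym2.mem_mk_left _ _⟩⟩
  obtain ⟨B, h1, h2, h3, h4⟩ := (hasCliqueModel_of_dense t (touched A) hne
    (by rw [hcount]; omega)).mono (subset_univ _)
  refine h ⟨B, h1, fun i => (h2 i).mono ?_, h3, fun i j hij => ?_⟩
  · exact fun u v huv => hHG huv
  · obtain ⟨u, hu, v, hv, huv⟩ := h4 i j hij
    exact ⟨u, hu, v, hv, hHG huv⟩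

/-- The graphs of a proper minor-closed family have orientations of bounded outdegree. -/
theorem GraphFamily.IsMinorClosed.exists_hasOrientation {F : GraphFamily} (hF : F.IsMinorClosed)
    (hP : F.IsProper) : ∃ d : ℕ, ∀ n, ∀ G ∈ F n, HasOrientation G d := by
  obtain ⟨t, H, hH⟩ := hP
  refine ⟨2 ^ t, fun n G hG => hasOrientation_of_sparse G _
    (card_le_of_not_hasCliqueModel ?_)⟩
  rintro ⟨B, -, h2, h3, h4⟩
  exact hH (hF t n H G hG ⟨B, h2, h3, fun a b hab => h4 a b hab.ne⟩)

/-! ## Planar graphs are sparse -/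

section Classes

variable {α : Type*} [Finite α]

/-- Passing from `r` to `s` can at most merge the classes of `a` and `b`. So the classes of `r`
other than that of `a` inject into the classes of `s`. -/
theorem card_quotient_le_succ {r s : Setoid α} (a b : α)
    (h : ∀ x y, s x y → r x y ∨ (r x a ∧ r b y) ∨ (r x b ∧ r a y)) :
    Nat.card (Quotient r) ≤ Nat.card (Quotient s) + 1 := by
  let f : Quotient r → Option (Quotient s) := fun q =>
    if q = Quotient.mk r a then none else some (Quotient.mk s q.out)
  have hf : Function.Injective f := by
    intro q q' hqq
    by_cases hq : q = Quotient.mk r a <;> by_cases hq' : q' = Quotient.mk r a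
    · rw [hq, hq']
    · simp [f, hq, hq'] at hqq
    · simp [f, hq, hq'] at hqq
    · simp only [f, if_neg hq, if_neg hq', Option.some.injEq] at hqq
      rw [← q.out_eq] at hq ⊢
      rw [← q'.out_eq] at hq' ⊢
      rcases h _ _ (Quotient.exact hqq) with h | ⟨h, -⟩ | ⟨-, h⟩
      · exact Quotient.sound h
      · exact absurd (Quotient.sound h) hq
      · exact absurd (Quotient.sound (r.symm h)) hq'
  simpa using Nat.card_le_card_of_injective f hf

theorem card_quotient_le_of_le {r s : Setoid α} (h : ∀ x y, r x y → s x y) :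
    Nat.card (Quotient s) ≤ Nat.card (Quotient r) :=
  Nat.card_le_card_of_surjective (Quotient.map' id h) (by
    rintro ⟨x⟩
    exact ⟨Quotient.mk r x, rfl⟩)

theorem card_quotient_lt_of_lt {r s : Setoid α} (h : ∀ x y, r x y → s x y) {a b : α}
    (hs : s a b) (hr : ¬ r a b) : Nat.card (Quotient s) + 1 ≤ Nat.card (Quotient r) := by
  have : Fintype α := Fintype.ofFinite α
  have hf : Function.Surjective (Quotient.map' id h : Quotient r → Quotient s) := by
    rintro ⟨x⟩
    exact ⟨Quotient.mk r x, rfl⟩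
  rw [Nat.card_eq_fintype_card, Nat.card_eq_fintype_card]
  refine Fintype.card_lt_of_surjective_not_injective _ hf fun hinj => hr ?_
  have : Quotient.map' id h (Quotient.mk r a) = Quotient.map' id h (Quotient.mk r b) :=
    Quotient.sound hs
  exact Quotient.exact (hinj this)

end Classes

/-! ### Cycles of a permutation multiplied by a transposition -/

section Transposition

open Equiv Equiv.Perm

/-- To prove that a property holds on the cycle of `x`, it is enough to go forward. -/
theorem sameCycle_induction {α : Type*} [Finite α] {ψ : Perm α} {p : α → Prop} {x y : α} (h : ψ.SameCycle x y) (hx : p x)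
    (hs : ∀ z, p z → p (ψ z)) : p y := by
  obtain ⟨n, rfl⟩ := h.exists_nat_pow_eq
  induction n with
  | zero => exact hx
  | succ n ih =>
    rw [pow_succ', Perm.mul_apply]
    exact hs _ (ih ⟨n, by simp⟩)

variable {α : Type*} [Finite α] [DecidableEq α] {ψ : Perm α} {a b : α}

/-- The two cycles are joined: the product sends `a` to `ψ b` and then follows the old cycle of `b`,
which avoids `a`, until it arrives at `b`. -/
theorem sameCycle_mul_swap (h : ¬ ψ.SameCycle a b) : (ψ * swap a b).SameCycle a b := by
  have key : ∀ j : ℕ, (ψ * swap a b).SameCycle a ((ψ ^ (j + 1)) b) ∨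
      (ψ * swap a b).SameCycle a b := by
    intro j
    induction j with
    | zero => exact .inl ⟨1, by simp⟩
    | succ j ih =>
      rcases ih with ih | ih
      · by_cases hb : (ψ ^ (j + 1)) b = b
        · rw [hb] at ih
          exact .inr ih
        · have ha : (ψ ^ (j + 1)) b ≠ a := fun ha => h (SameCycle.symm ⟨(j + 1 : ℕ), by
            rw [zpow_natCast]; exact ha⟩)
          left
          have : (ψ ^ (j + 1 + 1)) b = (ψ * swap a b) ((ψ ^ (j + 1)) b) := by
            rw [pow_succ' ψ (j + 1), Perm.mul_apply, Perm.mul_apply, swap_apply_of_ne_of_ne ha hb]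
          rw [this]
          exact ih.trans ⟨1, by simp⟩
      · exact .inr ih
  have hpos := orderOf_pos ψ
  rcases key (orderOf ψ - 1) with h | h
  · rwa [Nat.sub_add_cancel hpos, pow_orderOf_eq_one] at h
  · exact h

theorem sameCycle_of_mul_swap {x y : α} (h : (ψ * swap a b).SameCycle x y) :
    ψ.SameCycle x y ∨ (ψ.SameCycle x a ∧ ψ.SameCycle b y) ∨
      (ψ.SameCycle x b ∧ ψ.SameCycle a y) := by
  have hstep : ∀ z, ψ.SameCycle z (ψ z) := fun z => ⟨1, by simp⟩
  refine sameCycle_induction (p := fun y => ψ.SameCycle x y ∨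
    (ψ.SameCycle x a ∧ ψ.SameCycle b y) ∨ (ψ.SameCycle x b ∧ ψ.SameCycle a y))
    h (.inl (SameCycle.refl _ _)) fun z hz => ?_
  rw [Perm.mul_apply]
  by_cases hza : z = a
  · subst hza
    rw [swap_apply_left]
    rcases hz with hz | ⟨hz, -⟩ | ⟨hz, -⟩
    · exact .inr (.inl ⟨hz, hstep b⟩)
    · exact .inr (.inl ⟨hz, hstep b⟩)
    · exact .inl (hz.trans (hstep b))
  by_cases hzb : z = b
  · subst hzb
    rw [swap_apply_right]
    rcases hz with hz | ⟨hz, -⟩ | ⟨hz, -⟩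
    · exact .inr (.inr ⟨hz, hstep a⟩)
    · exact .inl (hz.trans (hstep a))
    · exact .inr (.inr ⟨hz, hstep a⟩)
  rw [swap_apply_of_ne_of_ne hza hzb]
  rcases hz with hz | ⟨hz, hz'⟩ | ⟨hz, hz'⟩
  · exact .inl (hz.trans (hstep z))
  · exact .inr (.inl ⟨hz, hz'.trans (hstep z)⟩)
  · exact .inr (.inr ⟨hz, hz'.trans (hstep z)⟩)

/-- The number of cycles of a permutation, fixed points included. -/
def numCycles (ψ : Perm α) : ℕ := Nat.card (Quotient (SameCycle.setoid ψ))

theorem numCycles_le_mul_swap : numCycles ψ ≤ numCycles (ψ * swap a b) + 1 :=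
  card_quotient_le_succ a b fun _ _ h => sameCycle_of_mul_swap h

/-- If `a` and `b` lie on different cycles of the product, multiplying by the transposition again
joins these cycles. So `a` and `b` shared a cycle of `ψ`, which has been split. -/
theorem numCycles_lt_mul_swap (h : ¬ (ψ * swap a b).SameCycle a b) :
    numCycles ψ + 1 ≤ numCycles (ψ * swap a b) := by
  have hab : ψ.SameCycle a b := by
    have := sameCycle_mul_swap h
    rwa [mul_assoc, swap_mul_self, mul_one] at this
  refine card_quotient_lt_of_lt (fun x y hxy => ?_) hab h
  rcases sameCycle_of_mul_swap hxy with h | ⟨h, h'⟩ | ⟨h, h'⟩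
  · exact h
  · exact h.trans (hab.trans h')
  · exact h.trans (hab.symm.trans h')

end Transposition

/-! ### Deleting edges from an embedded graph -/

section Embedding

variable {V : Type*} {G : SimpleGraph V}

/-- The permutation that reverses the darts of the edges in `A` and fixes the other darts. -/
def flipPerm (G : SimpleGraph V) (A : Finset (Sym2 V)) : Equiv.Perm G.Dart :=
  Function.Involutive.toPerm (fun d => if d.edge ∈ A then d.symm else d) fun d => by
    by_cases h : d.edge ∈ A <;> simp [h]

/-- The face permutation of the subgraph with edge set `A`. Darts of deleted edges are kept as
half-edges. -/
def subfacePerm (σ : Equiv.Perm G.Dart) (A : Finset (Sym2 V)) : Equiv.Perm G.Dart :=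
  σ * flipPerm G A

variable {σ : Equiv.Perm G.Dart} {A : Finset (Sym2 V)}

theorem subfacePerm_of_mem {d : G.Dart} (h : d.edge ∈ A) : subfacePerm σ A d = σ d.symm :=
  congrArg σ (if_pos h)

theorem subfacePerm_of_notMem {d : G.Dart} (h : d.edge ∉ A) : subfacePerm σ A d = σ d :=
  congrArg σ (if_neg h)

theorem subfacePerm_erase {d : G.Dart} (h : d.edge ∈ A) :
    subfacePerm σ (A.erase d.edge) = subfacePerm σ A * Equiv.swap d d.symm := by
  ext1 x
  rw [Equiv.Perm.mul_apply]
  by_cases h1 : x = d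
  · subst h1
    rw [Equiv.swap_apply_left, subfacePerm_of_notMem (by simp),
      subfacePerm_of_mem (by rwa [SimpleGraph.Dart.edge_symm]), SimpleGraph.Dart.symm_symm]
  by_cases h2 : x = d.symm
  · subst h2
    rw [Equiv.swap_apply_right, subfacePerm_of_notMem (by simp), subfacePerm_of_mem h]
  have h3 : x.edge ≠ d.edge := by
    rw [Ne, SimpleGraph.dart_edge_eq_iff]
    tauto
  rw [Equiv.swap_apply_of_ne_of_ne h1 h2]
  by_cases hx : x.edge ∈ A
  · rw [subfacePerm_of_mem hx, subfacePerm_of_mem (mem_erase.2 ⟨h3, hx⟩)]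
  · rw [subfacePerm_of_notMem hx, subfacePerm_of_notMem fun h => hx (mem_of_mem_erase h)]

/-- The face of a dart. -/
def faceOf (σ : Equiv.Perm G.Dart) (A : Finset (Sym2 V)) (d : G.Dart) :
    Quotient (Equiv.Perm.SameCycle.setoid (subfacePerm σ A)) := Quotient.mk _ d

theorem faceOf_apply (d : G.Dart) : faceOf σ A (subfacePerm σ A d) = faceOf σ A d :=
  Quotient.sound (show (subfacePerm σ A).SameCycle _ _ from
    Equiv.Perm.SameCycle.symm ⟨1, by simp⟩)

theorem IsRotationSystem.fst_apply (hσ : IsRotationSystem G σ) (d : G.Dart) :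
    (σ d).fst = d.fst := ((hσ d (σ d)).1 ⟨1, by simp⟩).symm

/-- The subgraph with edge set `A`. -/
def sub (A : Finset (Sym2 V)) : SimpleGraph V := SimpleGraph.fromEdgeSet (A : Set (Sym2 V))

theorem sub_adj_dart {d : G.Dart} (h : d.edge ∈ A) : (sub A).Adj d.fst d.snd :=
  (SimpleGraph.fromEdgeSet_adj _).2 ⟨h, d.adj.ne⟩

/-- Each step of the walk turns around a vertex, after crossing an edge of `A` or at a half-edge
without crossing it. -/
theorem reachable_of_sameCycle [Fintype V] (hσ : IsRotationSystem G σ) {x y : G.Dart}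
    (h : (subfacePerm σ A).SameCycle x y) : (sub A).Reachable x.fst y.fst := by
  refine sameCycle_induction (p := fun z => (sub A).Reachable x.fst z.fst) h
    (SimpleGraph.Reachable.refl _) fun z hz => hz.trans ?_
  by_cases hzA : z.edge ∈ A
  · rw [subfacePerm_of_mem hzA, hσ.fst_apply]
    exact (sub_adj_dart hzA).reachable
  · rw [subfacePerm_of_notMem hzA, hσ.fst_apply]

theorem reachable_erase {d : G.Dart} {x y : V} (h : (sub A).Reachable x y) :
    (sub (A.erase d.edge)).Reachable x y ∨
      ((sub (A.erase d.edge)).Reachable x d.fst ∧ (sub (A.erase d.edge)).Reachable d.snd y) ∨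
      ((sub (A.erase d.edge)).Reachable x d.snd ∧ (sub (A.erase d.edge)).Reachable d.fst y) := by
  rw [SimpleGraph.reachable_iff_reflTransGen] at h
  induction h with
  | refl => exact .inl (SimpleGraph.Reachable.refl _)
  | @tail y z _ hyz ih =>
    by_cases he : s(y, z) = d.edge
    · rcases Sym2.eq_iff.1 (he.trans (show d.edge = s(d.fst, d.snd) from rfl)) with
        ⟨rfl, rfl⟩ | ⟨rfl, rfl⟩
      · rcases ih with ih | ⟨ih, -⟩ | ⟨ih, -⟩
        · exact .inr (.inl ⟨ih, SimpleGraph.Reachable.refl _⟩)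
        · exact .inr (.inl ⟨ih, SimpleGraph.Reachable.refl _⟩)
        · exact .inl ih
      · rcases ih with ih | ⟨ih, -⟩ | ⟨ih, -⟩
        · exact .inr (.inr ⟨ih, SimpleGraph.Reachable.refl _⟩)
        · exact .inl ih
        · exact .inr (.inr ⟨ih, SimpleGraph.Reachable.refl _⟩)
    · have hadj : (sub (A.erase d.edge)).Reachable y z := by
        have := (SimpleGraph.fromEdgeSet_adj _).1 hyz
        exact SimpleGraph.Adj.reachable
          ((SimpleGraph.fromEdgeSet_adj _).2 ⟨mem_erase.2 ⟨he, this.1⟩, this.2⟩)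
      rcases ih with ih | ⟨ih, ih'⟩ | ⟨ih, ih'⟩
      · exact .inl (ih.trans hadj)
      · exact .inr (.inl ⟨ih, ih'.trans hadj⟩)
      · exact .inr (.inr ⟨ih, ih'.trans hadj⟩)

/-- The number of connected components of the subgraph with edge set `A`. -/
def numComponents (A : Finset (Sym2 V)) : ℕ := Nat.card (sub A).ConnectedComponent

variable [Fintype V]

theorem numComponents_erase_le (d : G.Dart) :
    numComponents (A.erase d.edge) ≤ numComponents A + 1 :=
  card_quotient_le_succ (r := (sub (A.erase d.edge)).reachableSetoid)
    (s := (sub A).reachableSetoid) d.fst d.snd fun _ _ h => reachable_erase h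

theorem numComponents_erase_le_of_reachable {d : G.Dart}
    (h : (sub (A.erase d.edge)).Reachable d.fst d.snd) :
    numComponents (A.erase d.edge) ≤ numComponents A :=
  card_quotient_le_of_le (r := (sub A).reachableSetoid)
    (s := (sub (A.erase d.edge)).reachableSetoid) fun x y hxy => by
      rcases reachable_erase (d := d) hxy with h' | ⟨h1, h2⟩ | ⟨h1, h2⟩
      · exact h'
      · exact h1.trans (h.trans h2)
      · exact h1.trans (h.symm.trans h2)

/-- The genus does not increase if an edge is deleted. -/
theorem euler_erase (hσ : IsRotationSystem G σ) {d : G.Dart} (hd : d.edge ∈ A) {K : ℕ}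
    (h : 2 * numComponents A + #A ≤ K + numCycles (subfacePerm σ A)) :
    2 * numComponents (A.erase d.edge) + #(A.erase d.edge) ≤
      K + numCycles (subfacePerm σ (A.erase d.edge)) := by
  have hcard := card_erase_add_one hd
  -- If both darts lie on one face after the deletion, the ends of the edge are still connected
  -- along it, and at most one face has been lost, which the lost edge pays for. Otherwise the
  -- number of faces has grown, which together with the lost edge pays for a possible new component.
  by_cases hc : (subfacePerm σ (A.erase d.edge)).SameCycle d d.symm
  · have h1 := numComponents_erase_le_of_reachable (reachable_of_sameCycle hσ hc)
    have h2 := numCycles_le_mul_swap (ψ := subfacePerm σ A) (a := d) (b := d.symm)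
    rw [← subfacePerm_erase hd] at h2
    omega
  · have h1 := numComponents_erase_le (A := A) d
    have h2 := numCycles_lt_mul_swap (ψ := subfacePerm σ A) (a := d) (b := d.symm)
    rw [← subfacePerm_erase hd] at h2
    have := h2 hc
    omega

theorem exists_dart_edge {e : Sym2 V} (he : e ∈ G.edgeFinset) {v : V} (hv : v ∈ e) :
    ∃ d : G.Dart, d.edge = e ∧ d.fst = v := by
  obtain ⟨w, rfl⟩ := hv
  exact ⟨⟨(v, w), SimpleGraph.mem_edgeFinset.1 he⟩, rfl, rfl⟩

/-- The isolated vertices. -/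
def isolated (G : SimpleGraph V) : Finset V := {v | ∀ u, ¬ G.Adj v u}

/-- The edges outside `A` are deleted one by one from `G`, where planarity gives equality. Isolated
vertices of `G` have no darts and are counted separately; a vertex that becomes isolated later keeps
its half-edges, and they form a cycle. -/
theorem euler_sub (hσ : IsRotationSystem G σ)
    (h : Nat.card V + numFaces σ = Nat.card G.edgeSet + 2 * Nat.card G.ConnectedComponent)
    (hA : A ⊆ G.edgeFinset) :
    2 * numComponents A + #A ≤
      Fintype.card V + #(isolated G) + numCycles (subfacePerm σ A) := by
  have key : ∀ S : Finset (Sym2 V), S ⊆ G.edgeFinset →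
      2 * numComponents (G.edgeFinset \ S) + #(G.edgeFinset \ S) ≤
        Fintype.card V + #(isolated G) + numCycles (subfacePerm σ (G.edgeFinset \ S)) := by
    intro S
    induction S using Finset.induction_on with
    | empty =>
      intro _
      rw [sdiff_empty]
      have h1 : sub G.edgeFinset = G := by
        rw [sub, SimpleGraph.coe_edgeFinset, SimpleGraph.fromEdgeSet_edgeSet]
      have h2 : subfacePerm σ G.edgeFinset = facePerm σ := by
        ext1 d
        rw [subfacePerm_of_mem (SimpleGraph.mem_edgeFinset.2 d.edge_mem)]
        rfl
      have h3 : Nat.card {v : V // ∀ u, ¬ G.Adj v u} = #(isolated G) := by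
        rw [Nat.card_eq_fintype_card, Fintype.card_subtype, isolated]
      have h4 : Nat.card G.edgeSet = #G.edgeFinset := by
        rw [Nat.card_eq_fintype_card, SimpleGraph.edgeFinset_card]
      rw [numComponents, h1, h2, ← h4]
      unfold numFaces at h
      rw [h3, Nat.card_eq_fintype_card (α := V)] at h
      unfold numCycles
      omega
    | insert e S heS ih =>
      intro hS
      rw [insert_subset_iff] at hS
      have he : e ∈ G.edgeFinset \ S := mem_sdiff.2 ⟨hS.1, heS⟩
      obtain ⟨d, rfl⟩ : ∃ d : G.Dart, d.edge = e := by
        induction e with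
        | h u v => exact ⟨⟨(u, v), SimpleGraph.mem_edgeFinset.1 hS.1⟩, rfl⟩
      rw [sdiff_insert]
      exact euler_erase hσ he (ih hS.2)
  have := key (G.edgeFinset \ A) sdiff_subset
  rwa [Finset.sdiff_sdiff_eq_self hA] at this

/-! ### Counting faces -/

/-- The darts of the edges in `A` on a face. -/
def boundary (σ : Equiv.Perm G.Dart) (A : Finset (Sym2 V))
    (q : Quotient (Equiv.Perm.SameCycle.setoid (subfacePerm σ A))) : Finset G.Dart :=
  {d | faceOf σ A d = q ∧ d.edge ∈ A}

variable {q : Quotient (Equiv.Perm.SameCycle.setoid (subfacePerm σ A))}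

theorem mem_boundary {d : G.Dart} : d ∈ boundary σ A q ↔ faceOf σ A d = q ∧ d.edge ∈ A := by
  simp [boundary]

/-- A facial walk enters every vertex as often as it leaves it. -/
theorem card_boundary_snd (hσ : IsRotationSystem G σ) (v : V) :
    #{d ∈ boundary σ A q | d.snd = v} = #{d ∈ boundary σ A q | d.fst = v} := by
  have h1 : #{d | faceOf σ A d = q ∧ (subfacePerm σ A d).fst = v} =
      #{d | faceOf σ A d = q ∧ d.fst = v} := by
    refine card_bijective (subfacePerm σ A) (subfacePerm σ A).bijective fun d => ?_
    simp [faceOf_apply]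
  have h2 : #{d | faceOf σ A d = q ∧ (subfacePerm σ A d).fst = v} =
      #{d ∈ boundary σ A q | d.snd = v} +
        #{d | faceOf σ A d = q ∧ d.edge ∉ A ∧ d.fst = v} := by
    rw [← card_union_of_disjoint]
    · congr 1
      ext d
      simp only [mem_filter, mem_univ, true_and, mem_union, mem_boundary]
      by_cases hd : d.edge ∈ A
      · rw [subfacePerm_of_mem hd, hσ.fst_apply]; simp [hd]
      · rw [subfacePerm_of_notMem hd, hσ.fst_apply]; simp [hd]
    · refine disjoint_left.2 fun d hd hd' => ?_
      simp only [mem_filter, mem_univ, true_and, mem_boundary] at hd hd'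
      exact hd'.2.1 hd.1.2
  have h3 : #{d | faceOf σ A d = q ∧ d.fst = v} =
      #{d ∈ boundary σ A q | d.fst = v} +
        #{d | faceOf σ A d = q ∧ d.edge ∉ A ∧ d.fst = v} := by
    rw [← card_union_of_disjoint]
    · congr 1
      ext d
      simp only [mem_filter, mem_univ, true_and, mem_union, mem_boundary]
      by_cases hd : d.edge ∈ A <;> simp [hd]
    · refine disjoint_left.2 fun d hd hd' => ?_
      simp only [mem_filter, mem_univ, true_and, mem_boundary] at hd hd'
      exact hd'.2.1 hd.1.2
  omega

/-- Entries and exits balance at both ends of `a`: some boundary dart leaves its head and some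
boundary dart enters its tail. Neither is `a`, so with at most two boundary darts they coincide and
form the reversal of `a`. -/
theorem symm_mem_boundary (hσ : IsRotationSystem G σ) (hq : #(boundary σ A q) ≤ 2) {a : G.Dart}
    (ha : a ∈ boundary σ A q) : a.symm ∈ boundary σ A q := by
  obtain ⟨b, hb⟩ : ({d ∈ boundary σ A q | d.fst = a.snd} : Finset G.Dart).Nonempty := by
    rw [← card_pos, ← card_boundary_snd hσ]
    exact card_pos.2 ⟨a, mem_filter.2 ⟨ha, rfl⟩⟩
  obtain ⟨c, hc⟩ : ({d ∈ boundary σ A q | d.snd = a.fst} : Finset G.Dart).Nonempty := by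
    rw [← card_pos, card_boundary_snd hσ]
    exact card_pos.2 ⟨a, mem_filter.2 ⟨ha, rfl⟩⟩
  rw [mem_filter] at hb hc
  have hab : a ≠ b := by
    rintro rfl
    exact a.adj.ne hb.2
  have hac : a ≠ c := by
    rintro rfl
    exact a.adj.ne hc.2.symm
  have hbc : b = c := by
    by_contra hbc
    have h3 : #({a, b, c} : Finset G.Dart) = 3 := card_eq_three.2 ⟨a, b, c, hab, hac, hbc, rfl⟩
    have : #({a, b, c} : Finset G.Dart) ≤ #(boundary σ A q) := card_le_card (by
      intro d hd
      simp only [mem_insert, mem_singleton] at hd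
      rcases hd with rfl | rfl | rfl
      exacts [ha, hb.1, hc.1])
    omega
  have : b = a.symm := by
    subst hbc
    exact SimpleGraph.Dart.ext _ _ (Prod.ext hb.2 hc.2)
  exact this ▸ hb.1

/-- A face with at most two boundary darts contains all darts at each of its vertices. -/
theorem faceOf_eq_of_fst_eq (hσ : IsRotationSystem G σ) (hq : #(boundary σ A q) ≤ 2)
    {x y : G.Dart} (hx : faceOf σ A x = q) (hxy : x.fst = y.fst) : faceOf σ A y = q := by
  refine sameCycle_induction (p := fun z => faceOf σ A z = q) ((hσ x y).2 hxy) hx fun z hz => ?_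
  by_cases hzA : z.edge ∈ A
  -- The reversal of `z` is on the face too, and its successor on the face is `σ z`. So the face is
  -- preserved by rotation about the vertex.
  · have h := (mem_boundary.1 (symm_mem_boundary hσ hq (mem_boundary.2 ⟨hz, hzA⟩))).1
    rw [← faceOf_apply, subfacePerm_of_mem (by rwa [SimpleGraph.Dart.edge_symm]),
      SimpleGraph.Dart.symm_symm] at h
    exact h
  · rw [← subfacePerm_of_notMem hzA, faceOf_apply]
    exact hz

theorem sum_card_boundary (hA : A ⊆ G.edgeFinset) : ∑ q, #(boundary σ A q) = 2 * #A := by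
  have h1 : #({d | d.edge ∈ A} : Finset G.Dart) = ∑ q, #(boundary σ A q) := by
    rw [card_eq_sum_card_fiberwise (f := faceOf σ A) (t := univ) fun _ _ => mem_univ _]
    refine sum_congr rfl fun q _ => congrArg card ?_
    ext d
    simp [mem_boundary, and_comm]
  have h2 : #({d | d.edge ∈ A} : Finset G.Dart) = ∑ e ∈ A, 2 := by
    have hmaps : ∀ d ∈ ({d | d.edge ∈ A} : Finset G.Dart), d.edge ∈ A :=
      fun d hd => (mem_filter.1 hd).2
    rw [card_eq_sum_card_fiberwise (f := SimpleGraph.Dart.edge) (t := A)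
      (s := {d | d.edge ∈ A}) hmaps]
    refine sum_congr rfl fun e he => ?_
    rw [← G.dart_edge_fiber_card e (SimpleGraph.mem_edgeFinset.1 (hA he))]
    congr 1
    ext d
    simp only [mem_filter, mem_univ, true_and, and_iff_right_iff_imp]
    rintro rfl
    exact he
  rw [← h1, h2, sum_const, smul_eq_mul, mul_comm]

/-- Each vertex that `A` does not touch is a component by itself. -/
theorem card_le_numComponents_add_touched (A : Finset (Sym2 V)) :
    Fintype.card V ≤ numComponents A + #(touched A) := by
  have h1 : #(touched A)ᶜ ≤ numComponents A := by
    rw [numComponents, Nat.card_eq_fintype_card, ← card_univ]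
    refine card_le_card_of_injOn (sub A).connectedComponentMk (fun _ _ => mem_univ _) ?_
    intro v hv w _ hvw
    have hr := SimpleGraph.ConnectedComponent.exact hvw
    by_contra hne
    rw [SimpleGraph.reachable_iff_reflTransGen] at hr
    obtain ⟨u, hu, -⟩ := hr.cases_head.resolve_left hne
    refine (mem_compl.1 hv) (mem_touched.2 ⟨s(v, u), ?_, Sym2.mem_mk_left _ _⟩)
    exact ((SimpleGraph.fromEdgeSet_adj _).1 hu).1
  have := card_compl_add_card (touched A)
  omega

/-- Let `t = #(touched A)`. A face without boundary darts surrounds a vertex that is isolated only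
after the deletion; with the isolated vertices of `G` these number at most `Fintype.card V - t`.
There are at least `Fintype.card V - t` components, so Euler's inequality gives `#A ≤ t + #Q₁`. The
faces in `Q₁` have three or more boundary darts, except for those in `Q₂`, at most `t` in number.
Hence `3 * #Q₁ ≤ 2 * #A + t`, and together `#A ≤ 4 * t`. -/
theorem IsPlanar.card_le (hG : IsPlanar G) (hA : A ⊆ G.edgeFinset) : #A ≤ 4 * #(touched A) := by
  obtain ⟨σ, hσ, h⟩ := hG
  have heuler := euler_sub hσ h hA
  have hsum := sum_card_boundary (σ := σ) hA
  have hcomp := card_le_numComponents_add_touched A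
  let Q := Quotient (Equiv.Perm.SameCycle.setoid (subfacePerm σ A))
  have hrep : ∀ q : Q, ∃ x : G.Dart, faceOf σ A x = q ∧
      ((boundary σ A q).Nonempty → x ∈ boundary σ A q) := fun q => by
    by_cases hq : (boundary σ A q).Nonempty
    · obtain ⟨x, hx⟩ := hq
      exact ⟨x, (mem_boundary.1 hx).1, fun _ => hx⟩
    · exact ⟨q.out, q.out_eq, fun h => absurd h hq⟩
  choose x hx hx' using hrep
  let Q₀ : Finset Q := {q | #(boundary σ A q) = 0}
  let Q₁ : Finset Q := {q | #(boundary σ A q) ≠ 0}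
  let Q₂ : Finset Q := {q | #(boundary σ A q) ≠ 0 ∧ #(boundary σ A q) ≤ 2}
  have hF : numCycles (subfacePerm σ A) = #Q₀ + #Q₁ := by
    rw [numCycles, Nat.card_eq_fintype_card, ← card_univ]
    exact (card_filter_add_card_filter_not _).symm
  -- A face with at most two boundary darts owns every dart at its vertices, so it is determined by
  -- any one of them.
  have hinj : ∀ q q' : Q, #(boundary σ A q) ≤ 2 → (x q).fst = (x q').fst → q = q' := by
    intro q q' hq hqq
    rw [← hx q', faceOf_eq_of_fst_eq hσ hq (hx q) hqq]
  have h2 : #Q₂ ≤ #(touched A) := by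
    refine card_le_card_of_injOn (fun q => (x q).fst) ?_ ?_
    · intro q hq
      have := hx' q (card_pos.1 (Nat.pos_of_ne_zero (mem_filter.1 hq).2.1))
      exact mem_touched.2 ⟨_, (mem_boundary.1 this).2, Sym2.mem_mk_left _ _⟩
    · exact fun q hq q' _ hqq => hinj q q' (mem_filter.1 hq).2.2 hqq
  have h0 : #Q₀ + #(isolated G) + #(touched A) ≤ Fintype.card V := by
    rw [← card_image_of_injOn (f := fun q => (x q).fst) (s := Q₀)
      fun q hq q' _ hqq => hinj q q' (by rw [(mem_filter.1 hq).2]; omega) hqq,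
      ← card_union_of_disjoint, ← card_union_of_disjoint]
    · exact card_le_univ _
    · refine disjoint_left.2 fun v hv hv' => ?_
      obtain ⟨e, he, hve⟩ := mem_touched.1 hv'
      obtain ⟨d, rfl, rfl⟩ := exists_dart_edge (hA he) hve
      rcases mem_union.1 hv with hv | hv
      · obtain ⟨q, hq, hqd⟩ := mem_image.1 hv
        have hq0 := (mem_filter.1 hq).2
        have := faceOf_eq_of_fst_eq hσ (by rw [hq0]; omega) (hx q) hqd
        rw [card_eq_zero] at hq0
        exact notMem_empty d (hq0 ▸ mem_boundary.2 ⟨this, he⟩)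
      · exact (mem_filter.1 hv).2 _ d.adj
    · refine disjoint_left.2 fun v hv hv' => ?_
      obtain ⟨q, hq, rfl⟩ := mem_image.1 hv
      exact (mem_filter.1 hv').2 _ (x q).adj
  -- A face in `Q₂` contains both darts of an edge, so it is only one short of three.
  have h3 : 3 * #Q₁ ≤ 2 * #A + #Q₂ := by
    rw [← hsum, card_filter, card_filter, mul_sum, ← sum_add_distrib]
    refine sum_le_sum fun q _ => ?_
    by_cases hq : #(boundary σ A q) ≤ 2
    · by_cases hq0 : #(boundary σ A q) = 0
      · simp [hq0]
      · obtain ⟨a, ha⟩ := card_pos.1 (Nat.pos_of_ne_zero hq0)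
        have : 2 ≤ #(boundary σ A q) := by
          rw [← card_pair a.symm_ne.symm]
          refine card_le_card fun d hd => ?_
          simp only [mem_insert, mem_singleton] at hd
          rcases hd with rfl | rfl
          exacts [ha, symm_mem_boundary hσ hq ha]
        rw [if_pos hq0, if_pos ⟨hq0, hq⟩]
        omega
    · rw [if_pos (by omega), if_neg (by omega)]
      omega
  omega

theorem IsPlanar.hasOrientation (hG : IsPlanar G) : HasOrientation G 4 :=
  hasOrientation_of_sparse G 4 fun _ hA => hG.card_le hA

end Embedding

/-! ## The encoding of an instance -/

theorem getD_flatMap {α : Type*} {f : α → List ℕ} {k : ℕ} (hf : ∀ a, (f a).length = k)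
    (l : List α) : ∀ (i r : ℕ) (hi : i < l.length), r < k →
      (l.flatMap f).getD (i * k + r) 0 = (f l[i]).getD r 0 := by
  induction l with
  | nil => intro i r hi; simp at hi
  | cons a l ih =>
    intro i r hi hr
    rw [List.flatMap_cons]
    cases i with
    | zero =>
      rw [List.getD_append _ _ _ _ (by rw [hf]; omega)]
      simp
    | succ i =>
      have : (i + 1) * k + r = k + (i * k + r) := by ring
      rw [List.getD_append_right _ _ _ _ (by rw [hf]; omega), hf, this, Nat.add_sub_cancel_left,
        ih i r (by simpa using hi) hr]
      simp

theorem length_flatMap_const {α : Type*} {f : α → List ℕ} {k : ℕ} (hf : ∀ a, (f a).length = k)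
    (l : List α) : (l.flatMap f).length = l.length * k := by
  simp [List.length_flatMap, hf]

theorem inputSize_append (l l' : List ℕ) : inputSize (l ++ l') = inputSize l + inputSize l' := by
  simp [inputSize]

theorem length_le_inputSize (l : List ℕ) : l.length ≤ inputSize l := by
  induction l with
  | nil => simp
  | cons a l ih =>
    simp only [inputSize, List.map_cons, List.sum_cons, List.length_cons] at ih ⊢
    omega

theorem size_getD_le_inputSize (l : List ℕ) (i : ℕ) : (l.getD i 0).size ≤ inputSize l := by
  induction l generalizing i with
  | nil => simp
  | cons a l ih =>
    simp only [inputSize, List.map_cons, List.sum_cons] at ih ⊢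
    cases i with
    | zero => simp only [List.getD_cons_zero]; omega
    | succ i => have := ih i; simp only [List.getD_cons_succ]; omega

section Encode

variable {n : ℕ} (G : SimpleGraph (Fin n)) (c x : Fin n → ℚ≥0)

/-- The memory at the start. -/
def instMem (i : ℕ) : ℕ := (encode G c x).getD i 0

theorem length_encode : (encode G c x).length = freeCell n := by
  unfold encode freeCell
  rw [List.length_append, List.length_append, List.length_append,
    length_flatMap_const (k := n) (by simp), length_flatMap_const (k := 2) (by simp),
    length_flatMap_const (k := 2) (by simp), List.length_finRange, List.length_singleton]
  ring

variable {G c x}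

theorem instMem_zero : instMem G c x 0 = n := by simp [instMem, encode]

theorem adjEntry_instMem (v u : Fin n) :
    adjEntry (instMem G c x) n v u = if G.Adj v u then 1 else 0 := by
  have h1 : (v : ℕ) * n + u < n * n := by
    have : (v : ℕ) * n + n ≤ n * n := by nlinarith [v.2]
    omega
  have hl := length_flatMap_const (f := fun u : Fin n => (List.finRange n).map fun v =>
    if G.Adj u v then 1 else 0) (k := n) (by simp) (List.finRange n)
  rw [List.length_finRange] at hl
  unfold adjEntry instMem encode
  rw [List.append_assoc, List.append_assoc, List.getD_append_right _ _ _ _ (by simp; omega),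
    List.length_singleton, List.getD_append _ _ _ _ (by rw [hl]; omega)]
  have : 1 + (v : ℕ) * n + u - 1 = v * n + u := by omega
  rw [this, getD_flatMap (k := n) (by simp) _ _ _ (by simp) u.2]
  simp

theorem instMem_cost (v : Fin n) (r : ℕ) (hr : r < 2) :
    instMem G c x (1 + n * n + 2 * v + r) = [(c v).num, (c v).den].getD r 0 := by
  have hl := length_flatMap_const (f := fun u : Fin n => (List.finRange n).map fun v =>
    if G.Adj u v then 1 else 0) (k := n) (by simp) (List.finRange n)
  have hl' := length_flatMap_const (f := fun v : Fin n => [(c v).num, (c v).den]) (k := 2)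
    (by simp) (List.finRange n)
  rw [List.length_finRange] at hl hl'
  have hv := v.2
  unfold instMem encode
  rw [List.getD_append _ _ _ _ (by
      rw [List.length_append, List.length_append, hl, hl', List.length_singleton]; omega),
    List.getD_append_right _ _ _ _ (by
      rw [List.length_append, hl, List.length_singleton]; omega),
    List.length_append, hl, List.length_singleton]
  have : 1 + n * n + 2 * (v : ℕ) + r - (1 + n * n) = v * 2 + r := by omega
  rw [this, getD_flatMap (k := 2) (by simp) _ _ _ (by simp) hr]
  simp

theorem instMem_val (v : Fin n) (r : ℕ) (hr : r < 2) :
    instMem G c x (1 + n * n + 2 * n + 2 * v + r) = [(x v).num, (x v).den].getD r 0 := by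
  have hl := length_flatMap_const (f := fun u : Fin n => (List.finRange n).map fun v =>
    if G.Adj u v then 1 else 0) (k := n) (by simp) (List.finRange n)
  have hl' := length_flatMap_const (f := fun v : Fin n => [(c v).num, (c v).den]) (k := 2)
    (by simp) (List.finRange n)
  rw [List.length_finRange] at hl hl'
  have hv := v.2
  unfold instMem encode
  rw [List.getD_append_right _ _ _ _ (by
      rw [List.length_append, List.length_append, hl, hl', List.length_singleton]; omega),
    List.length_append, List.length_append, hl, hl', List.length_singleton]
  have : 1 + n * n + 2 * n + 2 * (v : ℕ) + r - (1 + n * n + n * 2) = v * 2 + r := by omega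
  rw [this, getD_flatMap (k := 2) (by simp) _ _ _ (by simp) hr]
  simp

theorem costNum_instMem (v : Fin n) : costNum (instMem G c x) n v = (c v).num :=
  instMem_cost v 0 (by omega)

theorem costDen_instMem (v : Fin n) : costDen (instMem G c x) n v = (c v).den :=
  instMem_cost v 1 (by omega)

theorem valNum_instMem (v : Fin n) : valNum (instMem G c x) n v = (x v).num :=
  instMem_val v 0 (by omega)

theorem valDen_instMem (v : Fin n) : valDen (instMem G c x) n v = (x v).den :=
  instMem_val v 1 (by omega)

theorem prodDen_instMem : prodDen (instMem G c x) n = ∏ v, (c v).den := by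
  rw [prodDen, Finset.prod_range]
  exact prod_congr rfl fun v _ => costDen_instMem v

theorem prodDen_pos : 0 < prodDen (instMem G c x) n := by
  rw [prodDen_instMem]
  exact prod_pos fun v _ => (c v).den_pos

theorem instMem_lt (i : ℕ) : instMem G c x i < 2 ^ inputSize (encode G c x) :=
  Nat.size_le.1 (size_getD_le_inputSize _ _)

/-- The bit lengths of the factors bound that of the product by their sum, and the denominators are
all part of the input. -/
theorem prodDen_le : prodDen (instMem G c x) n ≤ 2 ^ inputSize (encode G c x) := by
  rw [prodDen_instMem]
  calc ∏ v, (c v).den ≤ ∏ v, 2 ^ (c v).den.size :=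
        prod_le_prod' fun v _ => (Nat.lt_size_self _).le
    _ = 2 ^ ∑ v, (c v).den.size := prod_pow_eq_pow_sum _ _ _
    _ ≤ _ := by
      refine Nat.pow_le_pow_right (by omega) ?_
      have h : inputSize ((List.finRange n).flatMap fun v => [(c v).num, (c v).den]) =
          ∑ v, ((1 + (c v).num.size) + (1 + (c v).den.size)) := by
        rw [Fin.sum_univ_def, inputSize]
        generalize List.finRange n = l
        induction l with
        | nil => rfl
        | cons a l ih =>
          rw [List.flatMap_cons, List.map_append, List.sum_append, ih]
          simp
      unfold encode
      rw [inputSize_append, inputSize_append, h]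
      have : ∑ v, (c v).den.size ≤ ∑ v, ((1 + (c v).num.size) + (1 + (c v).den.size)) :=
        sum_le_sum fun v _ => by omega
      omega

theorem freeCell_le : freeCell n ≤ inputSize (encode G c x) :=
  (length_encode G c x).symm.trans_le (length_le_inputSize _)

theorem bounds_instMem :
    Bounds (instMem G c x) n (2 ^ (3 * inputSize (encode G c x) + 5)) := by
  set S := inputSize (encode G c x) with hS
  -- With `B = 2 ^ S`, the input numbers, the product of the denominators and `n` are at most `B`, a
  -- scaled cost is at most `B * B`, and the sum of the scaled costs is at most the cube of `B`. The
  -- factor `32` covers the addresses and the additive constants.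
  have hM : 2 ^ (3 * S + 5) = 32 * (2 ^ S * (2 ^ S * 2 ^ S)) := by ring
  have hfree : freeCell n ≤ S := freeCell_le
  have hlt : S < 2 ^ S := Nat.lt_two_pow_self
  have hin := instMem_lt (G := G) (c := c) (x := x)
  have hprod := prodDen_le (G := G) (c := c) (x := x)
  rw [← hS] at hin hprod
  set B := 2 ^ S with hB
  have hB1 : 1 ≤ B := by omega
  have hBB : B ≤ B * B := Nat.le_mul_of_pos_left _ hB1
  have hBBB : B * B ≤ B * (B * B) := Nat.le_mul_of_pos_left _ hB1
  rw [hM]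
  unfold freeCell at hfree
  refine ⟨by omega, fun i _ => (hin i).le.trans (by omega), fun v hv => ?_, by omega, ?_, ?_⟩
  · have := costDen_instMem (G := G) (c := c) (x := x) ⟨v, hv⟩
    rw [show costDen (instMem G c x) n v = _ from this]
    exact (c ⟨v, hv⟩).den_pos
  · have h1 : ∑ v ∈ range n, scaledCost (instMem G c x) n v ≤ n * (B * B) := by
      rw [← smul_eq_mul]
      conv_rhs => rw [← card_range n]
      exact sum_le_card_nsmul _ _ _ fun v _ =>
        Nat.mul_le_mul (hin _).le ((Nat.div_le_self _ _).trans hprod)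
    have h2 : n * (B * B) ≤ B * (B * B) := Nat.mul_le_mul_right _ (by omega)
    omega
  · intro v _
    have h1 : valNum (instMem G c x) n v * (2 * n + 1) ≤ B * B :=
      Nat.mul_le_mul (hin _).le (by omega)
    omega

theorem dominated_instMem {δ : ℕ → ℕ} {w : Fin n} : Dominated (instMem G c x) n δ w ↔
    ∃ u ∈ closedNbhd G w, δ u = 1 := by
  constructor
  · rintro ⟨u, hu, h, h1⟩
    refine ⟨⟨u, hu⟩, mem_closedNbhd.2 ?_, h1⟩
    rcases h with rfl | h
    · exact .inl rfl
    · rw [show adjEntry (instMem G c x) n w u = _ from adjEntry_instMem w ⟨u, hu⟩] at h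
      right
      by_contra hn
      exact h (if_neg hn)
  · rintro ⟨u, hu, h1⟩
    refine ⟨u, u.2, ?_, h1⟩
    rcases mem_closedNbhd.1 hu with rfl | h
    · exact .inl rfl
    · right
      rw [adjEntry_instMem, if_pos h]
      exact one_ne_zero

theorem scaledCost_instMem (v : Fin n) : (scaledCost (instMem G c x) n v : ℝ) =
    c v * prodDen (instMem G c x) n := by
  have hd : ((c v).den : ℝ) ≠ 0 := by exact_mod_cast (c v).den_ne_zero
  have hdvd : (c v).den ∣ prodDen (instMem G c x) n := by
    rw [prodDen_instMem]
    exact dvd_prod_of_mem _ (mem_univ v)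
  rw [scaledCost, costNum_instMem, costDen_instMem, Nat.cast_mul, Nat.cast_div hdvd hd]
  have : (c v : ℝ) = (c v).num / (c v).den := NNRat.cast_def _
  rw [this]
  ring

theorem heavy_instMem (k : ℕ) (v : Fin n) : heavy (instMem G c x) n k v =
    if 1 ≤ (x v : ℝ) * (k + 1) then 1 else 0 := by
  have hd : (0 : ℝ) < (x v).den := by exact_mod_cast (x v).den_pos
  have hx : (x v : ℝ) = (x v).num / (x v).den := NNRat.cast_def _
  rw [heavy, valNum_instMem, valDen_instMem]
  have : (x v).den ≤ (x v).num * (k + 1) ↔ 1 ≤ (x v : ℝ) * (k + 1) := by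
    rw [hx, div_mul_eq_mul_div, one_le_div hd]
    exact_mod_cast Iff.rfl
  simp only [this]

/-- The index `2 * d` stands for the threshold `1 / (2 * d + 1)`. Dividing the program's integer
prices by the common factor `prodDen` gives admissible prices for `rounding_bound`. -/
theorem roundCost_instMem_le {d : ℕ} (hG : HasOrientation G d)
    (hx : IsFractional G fun v => (x v : ℝ)) :
    (roundCost (instMem G c x) n (2 * d) : ℝ) ≤
      prodDen (instMem G c x) n * ((2 * d + 1) * ∑ v, (c v : ℝ) * (x v : ℝ)) := by
  set m := instMem G c x with hm
  have hQ : (0 : ℝ) < prodDen m n := by exact_mod_cast prodDen_pos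
  have hb := rounding_bound (G := G) (p := fun v : Fin n => (price m n v : ℝ) / prodDen m n) hG
    (fun v => by positivity) hx (c := fun v => (c v : ℝ)) (by
      intro v u hu
      rw [div_le_iff₀ hQ, ← scaledCost_instMem]
      have : price m n v ≤ scaledCost m n u := Nat.sInf_le ⟨u, u.2, by
        rcases mem_closedNbhd.1 hu with rfl | h
        · exact .inl rfl
        · right
          rw [adjEntry_instMem, if_pos h]
          exact one_ne_zero, rfl⟩
      exact_mod_cast this) fun v => by positivity
  refine le_trans (le_of_eq ?_) (mul_le_mul_of_nonneg_left hb hQ.le)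
  rw [roundCost, Finset.sum_range, Finset.sum_range, mul_add, mul_sum, mul_sum, Nat.cast_add,
    Nat.cast_sum, Nat.cast_sum]
  congr 1
  · refine sum_congr rfl fun u _ => ?_
    rw [Nat.cast_mul, scaledCost_instMem, heavy_instMem]
    push_cast
    split_ifs <;> ring
  · refine sum_congr rfl fun v _ => ?_
    have : Dominated m n (heavy m n (2 * d)) v ↔
        ∃ u ∈ closedNbhd G v, 1 ≤ (x u : ℝ) * (2 * d + 1) := by
      rw [dominated_instMem]
      refine exists_congr fun u => and_congr_right fun _ => ?_
      rw [heavy_instMem]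
      push_cast
      split_ifs with h <;> simp [h]
    rw [extraPrice]
    by_cases h : ∃ u ∈ closedNbhd G v, 1 ≤ (x u : ℝ) * (2 * d + 1)
    · rw [if_pos h, if_pos (this.2 h)]; simp
    · rw [if_neg h, if_neg fun h' => h (this.1 h')]
      field_simp

end Encode

/-! ## The theorem -/

/-- The rounding program as a machine program. -/
def roundingProg : Prog := Cmd.rounding.code 0

theorem roundingProg_spec {n : ℕ} (G : SimpleGraph (Fin n)) (c x : Fin n → ℚ≥0) :
    ∃ (D : Finset (Fin n)) (t : ℕ), Returns roundingProg G c x D t ∧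
      t ≤ (Cmd.rounding.steps * (6 * Polynomial.X + 13)).eval (inputSize (encode G c x)) ∧
      IsDominating G D ∧ ∀ i < 2 * n + 1,
        prodDen (instMem G c x) n * ∑ v ∈ D, (c v : ℝ) ≤ roundCost (instMem G c x) n i := by
  set S := inputSize (encode G c x) with hS
  have hfree : freeCell n ≤ S := freeCell_le
  have hN : 2 * n + 1 ≤ S := by
    unfold freeCell at hfree
    nlinarith
  obtain ⟨s, t, hexec, ⟨best, ε, hε, hmem⟩, -, ht⟩ := Cmd.exec_code (M := 2 ^ (3 * S + 5))
    (N := S) Nat.one_le_two_pow Cmd.rounding 0 (startState (encode G c x)) _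
    (wp_rounding (m := instMem G c x) bounds_instMem hN instMem_zero)
  replace hmem : ∀ u < n, s.mem u = ε u := hmem
  refine ⟨({v | s.mem v = 1} : Finset (Fin n)), t, ⟨s, hexec, by simp⟩, ?_, ?_, ?_⟩
  -- The bound `2 ^ (3 * S + 5)` has `3 * S + 6` binary digits, so an instruction costs at most `6 *
  -- S + 13`.
  · refine ht.trans (le_of_eq ?_)
    rw [Nat.size_pow]
    simp only [Polynomial.eval_mul, Polynomial.eval_add, Polynomial.eval_X,
      Polynomial.eval_ofNat]
    ring
  · intro v hv
    obtain ⟨u, hu, h1⟩ := dominated_instMem.1 (hε.dom v v.2)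
    have huD : u ∈ ({v | s.mem v = 1} : Finset (Fin n)) := by
      simp [hmem u u.2, h1]
    rcases mem_closedNbhd.1 hu with rfl | h
    · exact absurd huD hv
    · exact ⟨u, huD, h⟩
  · intro i hi
    have h1 : (∑ u ∈ range n, scaledCost (instMem G c x) n u * ε u : ℕ) ≤
        roundCost (instMem G c x) n i := hε.cost.trans_le (hε.le i hi)
    refine le_trans (le_of_eq ?_) (Nat.cast_le (α := ℝ).2 h1)
    rw [Finset.sum_range, Nat.cast_sum, sum_filter, mul_sum]
    refine sum_congr rfl fun v _ => ?_
    rw [Nat.cast_mul, scaledCost_instMem, hmem v v.2]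
    have := hε.le_one v
    rcases Nat.le_one_iff_eq_zero_or_eq_one.1 this with h | h <;> simp [h, mul_comm]

theorem isPolyTimeRounding_roundingProg : IsPolyTimeRounding roundingProg :=
  ⟨_, fun _ G c x _ => by
    obtain ⟨D, t, h1, h2, h3, -⟩ := roundingProg_spec G c x
    exact ⟨D, t, h1, h2, h3⟩⟩

theorem isApproxOn_roundingProg {F : GraphFamily} {d : ℕ}
    (h : ∀ n, ∀ G ∈ F n, HasOrientation G d) : IsApproxOn roundingProg F (2 * d + 1) := by
  rintro n G hG c x hx D t ⟨s, hs, hD⟩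
  obtain ⟨D', t', ⟨s', hs', hD'⟩, -, -, hcost⟩ := roundingProg_spec G c x
  -- The claim is about an arbitrary halting run; determinism identifies its final state with that
  -- of the verified run.
  obtain rfl := hs.deterministic hs'
  obtain rfl : D = D' := by
    ext v
    rw [hD, hD']
  have hQ : (0 : ℝ) < prodDen (instMem G c x) n := by exact_mod_cast prodDen_pos
  -- With `min d n` in place of `d`, the threshold is among those that the program tries.
  have hG' : HasOrientation G (min d n) := by
    rcases min_choice d n with h' | h' <;> rw [h']
    · exact h n G hG
    · simpa using hasOrientation_card G
  have h1 := (hcost (2 * min d n) (by omega)).trans (roundCost_instMem_le hG' hx)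
  refine (le_of_mul_le_mul_left h1 hQ).trans ?_
  refine mul_le_mul_of_nonneg_right ?_ (sum_nonneg fun v _ => by positivity)
  have : min d n ≤ d := min_le_left _ _
  have : ((min d n : ℕ) : ℝ) ≤ d := by exact_mod_cast this
  linarith

theorem IntegralityGapLE.mono {F : GraphFamily} {r r' : ℝ} (h : IntegralityGapLE F r)
    (hr : r ≤ r') : IntegralityGapLE F r' := fun n G hG c hc =>
  (h n G hG c hc).trans (mul_le_mul_of_nonneg_right hr (Real.sInf_nonneg (by
    rintro z ⟨x, hx, rfl⟩
    exact sum_nonneg fun v _ => mul_nonneg (hc v) (hx.2 v))))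

theorem IsApproxOn.mono {P : Prog} {F : GraphFamily} {r r' : ℝ} (h : IsApproxOn P F r)
    (hr : r ≤ r') : IsApproxOn P F r' := fun n G hG c x hx D t hD =>
  (h n G hG c x hx D t hD).trans
    (mul_le_mul_of_nonneg_right hr (sum_nonneg fun v _ => by positivity))

end DomSet

end

theorem theorem3 :
    ∃ P : DomSet.Prog, DomSet.IsPolyTimeRounding P ∧
      (∀ F : DomSet.GraphFamily, F.IsMinorClosed → F.IsProper →
        ∃ r : ℝ, DomSet.IntegralityGapLE F r ∧ DomSet.IsApproxOn P F r) ∧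
      DomSet.IntegralityGapLE DomSet.planarGraphs 10 ∧
      DomSet.IsApproxOn P DomSet.planarGraphs 10 := by
  have hplanar : ∀ n, ∀ G ∈ DomSet.planarGraphs n, DomSet.HasOrientation G 4 :=
    fun n G hG => DomSet.IsPlanar.hasOrientation hG
  -- For planar graphs outdegree `4` yields the factor `2 * 4 + 1 = 9`, which is relaxed to `10`.
  refine ⟨DomSet.roundingProg, DomSet.isPolyTimeRounding_roundingProg, fun F hF hP => ?_,
    (DomSet.integralityGapLE_of_hasOrientation hplanar).mono (by norm_num),
    (DomSet.isApproxOn_roundingProg hplanar).mono (by norm_num)⟩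
  obtain ⟨d, hd⟩ := hF.exists_hasOrientation hP
  exact ⟨2 * d + 1, DomSet.integralityGapLE_of_hasOrientation hd,
    DomSet.isApproxOn_roundingProg hd⟩
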